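/- Let $k$ be a field and let $\mathcal A=\{a_1,\dots,a_n\}\subset\mathbb N^m$ be a set of $n$ (pairwise distinct) nonzero vectors. Its toric ideal $I_{\mathcal A}\subset k[x_1,\dots,x_n]$ is the kernel of the homomorphism of $k$-algebras $k[x_1,\dots,x_n]\to k[t_1,\dots,t_m]$, $x_i\mapsto t^{a_i}=t_1^{a_{i1}}\cdots t_m^{a_{im}}$. It is called a complete intersection if its minimal number of generators equals its height. For $\mathcal B\subset\mathbb N^m$ finite, let $\mathrm{Cone}(\mathcal B)$ be the set of linear combinations of elements of $\mathcal B$ with nonnegative real coefficients. Whenever $a_i\in\mathrm{Cone}(\mathcal A\setminus\{a_i\})$, put $$m_i:=\min\Big\{b\in\mathbb Z^+ \;\Big|\; b\,a_i\in\sum_{t\ne i}\mathbb N\,a_t\Big\}.$$ For $u,v\in\mathbb N^m$ let $\gcd\{u,v\}\in\mathbb N^m$ be the coordinatewise greatest common divisor (with $\gcd(0,0)=0$). **Theorem.** Suppose that $I_{\mathcal A}$ is a complete intersection, and that for some $1\le i<j\le n$ the numbers $m_i$ and $m_j$ are defined and $m_ia_i=m_ja_j$. Let $a'_i:=\gcd\{a_i,a_j\}$,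 $a'_r:=a_r$ for $r\in\{1,\dots,j-1\}\setminus\{i\}$, $a'_r:=a_{r+1}$ for $r\in\{j,\dots,n-1\}$, and $\mathcal A':=\{a'_1,\dots,a'_{n-1}\}=(\mathcal A\setminus\{a_i,a_j\})\cup\{\gcd\{a_i,a_j\}\}$. Then the vectors $a'_1,\dots,a'_{n-1}$ are nonzero and pairwise distinct, and: 1. $I_{\mathcal A'}\subset k[x_1,\dots,x_{n-1}]$ is a complete intersection, and $\mathrm{ht}(I_{\mathcal A'})=\mathrm{ht}(I_{\mathcal A})-1$. 2. Let $r\in\{1,\dots,n-1\}\setminus\{i\}$, and let $s:=r$ if $r<j$ and $s:=r+1$ if $r\ge j$, so that $a'_r=a_s$. Then $a'_r\in\mathrm{Cone}(\mathcal A'\setminus\{a'_r\})$ if and only if $a_s\in\mathrm{Cone}(\mathcal A\setminus\{a_s\})$, and in this case $m'_r=m_s$, where $m'_r:=\min\big\{b\in\mathbb Z^+ \mid b\,a'_r\in\sum_{t\in\{1,\dots,n-1\},\,t\neq r}\mathbb N\,a'_t\big\}$. -/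

import Mathlib

noncomputable section

/-- The toric ideal of the family `a` of vectors of `ℕ^m`: the kernel of the homomorphism of
`k`-algebras `k[x_i : i ∈ ι] → k[t_1, …, t_m]`, `x_i ↦ t^{a_i} = ∏ l, t_l ^ (a_i)_l`. -/
def toricIdeal (k : Type*) [Field k] {ι : Type*} {m : ℕ} (a : ι → Fin m → ℕ) :
    Ideal (MvPolynomial ι k) :=
  RingHom.ker (MvPolynomial.aeval (R := k)
    (fun i => ∏ l : Fin m, (MvPolynomial.X l : MvPolynomial (Fin m) k) ^ a i l))

/-- An ideal is a complete intersection if its minimal number of generators is its height.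
(In a Noetherian ring every ideal is finitely generated, so `spanFinrank` is that number.) -/
def IsCompleteIntersection {R : Type*} [CommRing R] (I : Ideal R) : Prop :=
  (Submodule.spanFinrank I : ℕ∞) = I.height

/-- `a i` lies in the real cone spanned by the other vectors of the family. -/
def MemConeOthers {ι : Type*} {m : ℕ} (a : ι → Fin m → ℕ) (i : ι) : Prop :=
  (fun l => (a i l : ℝ)) ∈
    PointedCone.hull ℝ ((fun t => (fun l => (a t l : ℝ) : Fin m → ℝ)) '' {t | t ≠ i})

/-- The least positive integer `b` such that `b • a i` is a combination of the other vectors of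
the family with coefficients in `ℕ`. It is meaningful if `MemConeOthers a i` holds; such a `b`
exists exactly in this case. -/
def critExp {ι : Type*} {m : ℕ} (a : ι → Fin m → ℕ) (i : ι) : ℕ :=
  sInf {b : ℕ | 0 < b ∧ b • a i ∈ AddSubmonoid.closure (a '' {t | t ≠ i})}

/-- The coordinatewise greatest common divisor (`Nat.gcd 0 0 = 0`). -/
def gcdVec {m : ℕ} (u v : Fin m → ℕ) : Fin m → ℕ := fun l => Nat.gcd (u l) (v l)

/-- The family obtained by deleting the entry at `j` (later entries move down by one place) and
replacing the entry `a i` by `gcd(a i, a j)`. -/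
def mergeGcd {n m : ℕ} (a : Fin (n + 1) → Fin m → ℕ) (i j : Fin (n + 1)) : Fin n → Fin m → ℕ :=
  fun r => if j.succAbove r = i then gcdVec (a i) (a j) else a (j.succAbove r)

end

/-! Put q = m_i, p = m_j. Minimality of q makes q and p coprime, so a_i = p·g and a_j = q·g with g =
gcd{a_i, a_j}. Let φ (`foldHom`) send x_i to y^p, x_j to y^q and every other variable to itself.
Then φ⁻¹(I_{A'}) = I_A, and φ kills the binomial f = x_i^q − x_j^p of I_A.

No element of I_A contains a pure power x_i^b with b < q, so f lies outside (x)·I_A. Graded Nakayama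
(`IsWeightHomogeneousIdeal.exists_generators`) then extends f to homogeneous generators f, f_2, …,
f_h of I_A, where h is the height because I_A is a complete intersection.

The heart is that φ(f_2), …, φ(f_h) generate I_{A'}. The target of φ is a finite module over the
source and is Cohen–Macaulay at the origin. Since f acts on it as zero, f_2, …, f_h, x_i lower its
dimension by their number, so they form a regular sequence on it (`isWeaklyRegular_map_foldHom`). If
g ∈ I_{A'}, coprimality of p and q puts some y^{pN}·g into the image of φ, hence into φ(I_A)·k[y];
regularity of φ(x_i) = y^p cancels the power (`eq_map_and_height_of_comap_foldHom_eq`). Thus I_{A'}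
is generated by a regular sequence of length h − 1.

The exponents m_s are governed by the pure powers of x_s in elements of I_A. Since I_{A'} is the
extension of I_A, pure powers of the unmerged variables can be compared through φ
(`critExp_eq_of_toricIdeal_eq_map`). -/

open RingTheory.Sequence IsLocalRing

/-! ### Depth and dimension of finite modules over Noetherian local rings. -/

section LocalCohenMacaulay

universe u

open Pointwise

/-- Let N be the set of elements killed by P. Nakayama gives y ∈ N outside xN. If y = xw, regularity
of x would force w ∈ N, so y is nonzero in M/xM while P and x both kill it. -/
lemma IsAssociatedPrime.exists_isAssociatedPrime_quotSMulTop {R M : Type*} [CommRing R]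
    [IsLocalRing R] [IsNoetherianRing R] [AddCommGroup M] [Module R M] [Module.Finite R M]
    {P : Ideal R} (hP : IsAssociatedPrime P M) {x : R} (hx : x ∈ maximalIdeal R)
    (hreg : IsSMulRegular M x) :
    ∃ Q : Ideal R, IsAssociatedPrime Q (QuotSMulTop x M) ∧ P ≤ Q ∧ x ∈ Q := by
  obtain ⟨hprime, z, hz⟩ := isAssociatedPrime_iff.mp hP
  have hz' : ∀ p ∈ P, p • z = 0 := fun p hp => by
    rw [hz, Submodule.mem_colon_singleton] at hp
    simpa using hp
  have hz0 : z ≠ 0 := by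
    rintro rfl
    apply hprime.ne_top
    rw [hz, Ideal.eq_top_iff_one, Submodule.mem_colon_singleton]
    simp
  let N : Submodule R M := Submodule.torsionBySet R M (P : Set R)
  have hzN : z ∈ N := by
    rw [Submodule.mem_torsionBySet_iff]
    exact fun p => hz' p.1 p.2
  have hle : ¬ N ≤ Ideal.span {x} • N := fun h => by
    have hbot := Submodule.eq_bot_of_le_smul_of_le_jacobson_bot _ N
      (IsNoetherian.noetherian N) h (by
        rw [jacobson_eq_maximalIdeal _ bot_ne_top, Ideal.span_singleton_le_iff_mem]
        exact hx)
    exact hz0 (by simpa [hbot] using hzN)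
  obtain ⟨y, hyN, hy⟩ := SetLike.not_le_iff_exists.mp hle
  have hy' : ∀ p ∈ P, p • y = 0 := fun p hp =>
    (Submodule.mem_torsionBySet_iff _ _).mp hyN ⟨p, hp⟩
  have hyx : (Submodule.Quotient.mk y : QuotSMulTop x M) ≠ 0 := by
    intro h
    rw [Submodule.Quotient.mk_eq_zero, Submodule.mem_smul_pointwise_iff_exists] at h
    obtain ⟨w, -, rfl⟩ := h
    apply hy
    rw [Submodule.ideal_span_singleton_smul]
    refine Submodule.smul_mem_pointwise_smul _ _ _ ?_
    rw [Submodule.mem_torsionBySet_iff]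
    intro p
    apply hreg
    simp only [smul_zero]
    rw [smul_comm]
    exact hy' p.1 p.2
  obtain ⟨Q, hQ, hQle⟩ := exists_le_isAssociatedPrime_of_isNoetherianRing R _ hyx
  refine ⟨Q, hQ, fun p hp => hQle ?_, hQle ?_⟩
  · rw [Submodule.mem_colon_singleton, ← Submodule.Quotient.mk_smul, hy' p hp]
    simp
  · rw [Submodule.mem_colon_singleton, ← Submodule.Quotient.mk_smul, Submodule.mem_bot,
      Submodule.Quotient.mk_eq_zero]
    exact Submodule.smul_mem_pointwise_smul _ _ _ trivial

/-- Depth is at most dim R/P for every associated prime P. Each regular element x replaces P by an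
associated prime of M/xM that contains P and x; as x ∉ P, the dimension of the quotient drops by at
least one. -/
lemma IsAssociatedPrime.length_le_ringKrullDim_quotient {R : Type*} [CommRing R]
    [IsLocalRing R] [IsNoetherianRing R] (rs : List R) (hrs : ∀ r ∈ rs, r ∈ maximalIdeal R) :
    ∀ {M : Type*} [AddCommGroup M] [Module R M] [Module.Finite R M] {P : Ideal R},
      IsRegular M rs → IsAssociatedPrime P M → (rs.length : WithBot ℕ∞) ≤ ringKrullDim (R ⧸ P) := by
  induction rs with
  | nil =>
    intro M _ _ _ P _ hP
    have := hP.isPrime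
    simpa using ringKrullDim_nonneg_of_nontrivial
  | cons x rs ih =>
    intro M _ _ _ P hreg hP
    rw [isRegular_cons_iff] at hreg
    obtain ⟨Q, hQ, hPQ, hxQ⟩ := hP.exists_isAssociatedPrime_quotSMulTop (hrs x (by simp)) hreg.1
    have hQl := ih (fun r hr => hrs r (by simp [hr])) hreg.2 hQ
    have hprime := hP.isPrime
    obtain ⟨_, z, hz⟩ := isAssociatedPrime_iff.mp hP
    have hxP : x ∉ P := by
      intro hxP
      rw [hz, Submodule.mem_colon_singleton, Submodule.mem_bot] at hxP
      have hz0 : z = 0 := hreg.1 (by simpa using hxP)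
      apply hprime.ne_top
      rw [hz, Ideal.eq_top_iff_one, Submodule.mem_colon_singleton]
      simp [hz0]
    have := ringKrullDim_succ_le_of_surjective (Ideal.Quotient.factor hPQ)
      (Ideal.Quotient.factor_surjective hPQ) (r := Ideal.Quotient.mk P x)
      (mem_nonZeroDivisors_of_ne_zero (by rwa [Ne, Ideal.Quotient.eq_zero_iff_mem]))
      (by simpa [Ideal.Quotient.eq_zero_iff_mem] using hxQ)
    refine le_trans ?_ this
    rw [List.length_cons]
    push_cast
    gcongr

/-- A zero divisor x lies in some associated prime P. Then V(P) is contained in the support of M/xM,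
so dim M/xM ≥ dim R/P, which is at least the length of `rs`. -/
lemma isSMulRegular_of_supportDim_quotSMulTop_lt {R M : Type*} [CommRing R]
    [IsLocalRing R] [IsNoetherianRing R] [AddCommGroup M] [Module R M] [Module.Finite R M]
    {rs : List R} (hrs : ∀ r ∈ rs, r ∈ maximalIdeal R) (hreg : IsRegular M rs)
    {x : R} (hdim : Module.supportDim R (QuotSMulTop x M) < rs.length) :
    IsSMulRegular M x := by
  by_contra hx
  have hx' : x ∈ {r | IsSMulRegular M r}ᶜ := hx
  rw [← biUnion_associatedPrimes_eq_compl_regular] at hx'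
  simp only [Set.mem_iUnion, SetLike.mem_coe] at hx'
  obtain ⟨P, hP, hxP⟩ := hx'
  have hP : IsAssociatedPrime P M := hP
  have hprime := hP.isPrime
  have hle := hP.length_le_ringKrullDim_quotient rs hrs hreg
  refine absurd (hle.trans ?_) (not_le.mpr hdim)
  rw [ringKrullDim_quotient]
  refine Order.krullDim_le_of_strictMono
    (fun q => ⟨q.1, ?_⟩ : PrimeSpectrum.zeroLocus (P : Set R) →
      Module.support R (QuotSMulTop x M)) (fun a b h => h)
  rw [Module.support_quotSMulTop]
  refine ⟨?_, ?_⟩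
  · rw [Module.support_eq_zeroLocus]
    have h := hP.annihilator_le
    rw [Submodule.annihilator_top] at h
    exact fun r hr => q.2 (h hr)
  · simpa using q.2 hxP

-- Depth drops by at most one modulo a nonzerodivisor, even one unrelated to `rs`: depth is detected
-- by vanishing of Ext from the residue field, and Ext^i(M/xM) sits between Ext^i(M) and
-- Ext^{i+1}(M).
open CategoryTheory Abelian in
lemma exists_isRegular_quotSMulTop {R M : Type u} [CommRing R]
    [IsLocalRing R] [IsNoetherianRing R] [AddCommGroup M] [Module R M] [Module.Finite R M]
    {rs : List R} (hrs : ∀ r ∈ rs, r ∈ maximalIdeal R) (hreg : IsRegular M rs)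
    {d : ℕ} (hd : rs.length = d + 1)
    {x : R} (hx : x ∈ maximalIdeal R) (hxreg : IsSMulRegular M x) :
    ∃ ss : List R, ss.length = d ∧ (∀ r ∈ ss, r ∈ maximalIdeal R) ∧
      IsRegular (QuotSMulTop x M) ss := by
  have key : ∀ {M : Type u} [AddCommGroup M] [Module R M] [Module.Finite R M] [Nontrivial M],
      maximalIdeal R • (⊤ : Submodule R M) < ⊤ := by
    intro M _ _ _ _
    refine lt_top_iff_ne_top.mpr fun h => ?_
    have := Submodule.eq_bot_of_le_smul_of_le_jacobson_bot (maximalIdeal R) (⊤ : Submodule R M)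
      Module.Finite.fg_top h.ge (by rw [jacobson_eq_maximalIdeal _ bot_ne_top])
    exact top_ne_bot this
  have := hreg.nontrivial
  have : Nontrivial (QuotSMulTop x M) := nontrivial_quotSMulTop_of_mem_maximalIdeal _ hx
  have h1 : ∀ i < d + 1, Subsingleton (Ext
      (ModuleCat.of R (Shrink.{u} (R ⧸ maximalIdeal R))) (ModuleCat.of R M) i) := by
    have e := (ModuleCat.exists_isRegular_tfae (maximalIdeal R) (d + 1)
      (ModuleCat.of R M) key).out 1 3
    exact e.mpr ⟨rs, hd, hrs, hreg⟩
  have e := (ModuleCat.exists_isRegular_tfae (maximalIdeal R) d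
    (ModuleCat.of R (QuotSMulTop x M)) key).out 3 1
  refine e.mpr fun i hi => ?_
  have zero1 := AddCommGrpCat.isZero_of_iff_subsingleton.mpr (h1 i (by omega))
  have zero2 := AddCommGrpCat.isZero_of_iff_subsingleton.mpr (h1 (i + 1) (by omega))
  exact AddCommGrpCat.subsingleton_of_isZero <| ShortComplex.Exact.isZero_of_both_zeros
    ((Ext.covariant_sequence_exact₃' _
      (IsSMulRegular.smulShortComplex_shortExact (M := ModuleCat.of R M) hxreg)) i (i + 1) rfl)
    (zero1.eq_zero_of_src _) (zero2.eq_zero_of_tgt _)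

lemma supportDim_le_supportDim_quotient_ofList_add_length {R : Type*} [CommRing R]
    [IsLocalRing R] [IsNoetherianRing R] (xs : List R) (hxs : ∀ x ∈ xs, x ∈ maximalIdeal R) :
    ∀ (M : Type*) [AddCommGroup M] [Module R M] [Module.Finite R M],
    Module.supportDim R M ≤
      Module.supportDim R (M ⧸ (Ideal.ofList xs • ⊤ : Submodule R M)) + xs.length := by
  induction xs with
  | nil =>
    intro M _ _ _
    rw [Ideal.ofList_nil, Submodule.bot_smul]
    simpa using (Module.supportDim_eq_of_equiv (Submodule.quotEquivOfEqBot
      (⊥ : Submodule R M) rfl)).ge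
  | cons x xs ih =>
    intro M _ _ _
    have h1 := Module.supportDim_le_supportDim_quotSMulTop_succ (M := M) (hxs x (by simp))
    have h2 := ih (fun r hr => hxs r (by simp [hr])) (QuotSMulTop x M)
    rw [← Module.supportDim_eq_of_equiv
      (Submodule.quotOfListConsSMulTopEquivQuotSMulTopInner M x xs)] at h2
    refine h1.trans ((add_le_add_left h2 1).trans ?_)
    rw [List.length_cons, add_assoc]
    push_cast
    exact le_rfl

/-- A sequence in the maximal ideal that cuts the dimension of the support down as far as
a regular sequence would is itself regular. -/
theorem isWeaklyRegular_of_supportDim_add_length_le {R : Type u} [CommRing R]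
    [IsLocalRing R] [IsNoetherianRing R] (xs : List R) (hxs : ∀ x ∈ xs, x ∈ maximalIdeal R) :
    ∀ {M : Type u} [AddCommGroup M] [Module R M] [Module.Finite R M] {rs : List R},
    (∀ r ∈ rs, r ∈ maximalIdeal R) → IsRegular M rs →
    Module.supportDim R (M ⧸ (Ideal.ofList xs • ⊤ : Submodule R M)) + xs.length ≤ rs.length →
    IsWeaklyRegular M xs := by
  induction xs with
  | nil => intro M _ _ _ rs _ _ _; exact IsWeaklyRegular.nil R M
  | cons x xs ih =>
    intro M _ _ _ rs hrs hreg hdim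
    have hx := hxs x (by simp)
    have hxs' : ∀ r ∈ xs, r ∈ maximalIdeal R := fun r hr => hxs r (by simp [hr])
    have := hreg.nontrivial
    have : Nontrivial (QuotSMulTop x M) := nontrivial_quotSMulTop_of_mem_maximalIdeal _ hx
    have h2 := supportDim_le_supportDim_quotient_ofList_add_length xs hxs' (QuotSMulTop x M)
    rw [Module.supportDim_eq_of_equiv
      (Submodule.quotOfListConsSMulTopEquivQuotSMulTopInner M x xs)] at hdim
    -- The tail lowers the dimension by at most its length, so the assumed total drop already forces
    -- M/xM to be small.
    have hle : Module.supportDim R (QuotSMulTop x M) + 1 ≤ rs.length := by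
      refine (add_le_add_left h2 1).trans (le_trans (le_of_eq ?_) hdim)
      rw [List.length_cons, add_assoc]
      push_cast
      rfl
    have hne : rs ≠ [] := by
      rintro rfl
      have h0 := Module.supportDim_ne_bot_of_nontrivial R (QuotSMulTop x M)
      obtain ⟨e, he⟩ := WithBot.ne_bot_iff_exists.mp h0
      rw [← he] at hle
      have : e + 1 ≤ 0 := by exact_mod_cast hle
      simp at this
    obtain ⟨d, hd⟩ : ∃ d, rs.length = d + 1 :=
      Nat.exists_eq_succ_of_ne_zero (by simpa using hne)
    have cancel : ∀ {u v : WithBot ℕ∞}, u + 1 ≤ v + 1 → u ≤ v := by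
      intro u v h
      induction u with
      | bot => exact bot_le
      | coe u =>
        induction v with
        | bot => simp [← WithBot.coe_one, ← WithBot.coe_add] at h
        | coe v =>
          have h : u + 1 ≤ v + 1 := by exact_mod_cast h
          exact_mod_cast (ENat.add_le_add_iff_right ENat.one_ne_top).mp h
    have hle' : Module.supportDim R (QuotSMulTop x M) ≤ d := by
      rw [hd] at hle
      push_cast at hle
      exact cancel hle
    have hxreg : IsSMulRegular M x := by
      refine isSMulRegular_of_supportDim_quotSMulTop_lt hrs hreg (lt_of_le_of_lt hle' ?_)
      rw [hd]
      exact_mod_cast Nat.lt_succ_self d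
    obtain ⟨ss, hss, hssm, hssreg⟩ := exists_isRegular_quotSMulTop hrs hreg hd hx hxreg
    refine (isWeaklyRegular_cons_iff M x xs).mpr ⟨hxreg, ih hxs' hssm hssreg ?_⟩
    rw [hss]
    rw [List.length_cons, hd] at hdim
    push_cast at hdim
    rw [← add_assoc] at hdim
    exact cancel hdim

end LocalCohenMacaulay

/-! ### Weighted homogeneous ideals and graded Nakayama. -/

section WeightHomogeneous

open MvPolynomial

variable {k : Type*} [Field k] {ι : Type*}

/-- The `k`-algebra map `x_l ↦ x_l T ^ (w l)`, whose coefficients are the weighted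
homogeneous components. -/
noncomputable def weightHom (k : Type*) [Field k] {ι : Type*} (w : ι → ℕ) :
    MvPolynomial ι k →ₐ[k] Polynomial (MvPolynomial ι k) :=
  aeval fun l => Polynomial.C (X l) * Polynomial.X ^ w l

/-- `g` is weighted homogeneous for the weights `w`. -/
def IsWeightHomogeneous (w : ι → ℕ) (g : MvPolynomial ι k) : Prop :=
  ∃ d, weightHom k w g = Polynomial.C g * Polynomial.X ^ d

/-- The ideal `I` contains the weighted homogeneous components of its elements. -/
def IsWeightHomogeneousIdeal (w : ι → ℕ) (I : Ideal (MvPolynomial ι k)) : Prop :=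
  ∀ g ∈ I, ∀ d, (weightHom k w g).coeff d ∈ I

@[simp]
lemma weightHom_X (w : ι → ℕ) (l : ι) :
    weightHom k w (X l) = Polynomial.C (X l) * Polynomial.X ^ w l := by
  simp [weightHom]

lemma eval_one_weightHom (w : ι → ℕ) (g : MvPolynomial ι k) :
    (weightHom k w g).eval 1 = g := by
  induction g using MvPolynomial.induction_on with
  | C c => rw [← algebraMap_eq, AlgHom.commutes, Polynomial.algebraMap_apply]; simp
  | add p q hp hq => simp [hp, hq]
  | mul_X p l hp => simp [hp]

lemma isWeightHomogeneous_monomial (w : ι → ℕ) (u : ι →₀ ℕ) (c : k) :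
    IsWeightHomogeneous w (monomial u c) := by
  induction u using Finsupp.induction with
  | zero =>
    refine ⟨0, ?_⟩
    rw [← C_apply, ← algebraMap_eq, AlgHom.commutes, Polynomial.algebraMap_apply]
    simp
  | single_add l e u _ _ ih =>
    obtain ⟨d, hd⟩ := ih
    refine ⟨d + e * w l, ?_⟩
    rw [add_comm, monomial_add_single, map_mul, hd, map_pow, weightHom_X, map_mul, map_pow,
      mul_pow, ← pow_mul, mul_comm e, pow_add]
    ring

lemma weightHom_coeff_weightHom (w : ι → ℕ) (g : MvPolynomial ι k) (d : ℕ) :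
    weightHom k w ((weightHom k w g).coeff d) =
      Polynomial.C ((weightHom k w g).coeff d) * Polynomial.X ^ d := by
  induction g using MvPolynomial.induction_on' with
  | monomial u c =>
    obtain ⟨e, he⟩ := isWeightHomogeneous_monomial w u c
    rw [he, Polynomial.coeff_C_mul_X_pow]
    split_ifs with h
    · rw [he, h]
    · simp
  | add p q hp hq => simp only [map_add, Polynomial.coeff_add, hp, hq, add_mul]

lemma isWeightHomogeneous_coeff_weightHom (w : ι → ℕ) (g : MvPolynomial ι k) (d : ℕ) :
    IsWeightHomogeneous w ((weightHom k w g).coeff d) :=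
  ⟨d, weightHom_coeff_weightHom w g d⟩

lemma mem_span_coeff_weightHom (w : ι → ℕ) (g : MvPolynomial ι k) :
    g ∈ Submodule.span k (Set.range (weightHom k w g).coeff) := by
  have h : (weightHom k w g).eval 1 ∈ Submodule.span k (Set.range (weightHom k w g).coeff) := by
    rw [Polynomial.eval_eq_sum_range]
    refine sum_mem fun d _ => ?_
    rw [one_pow, mul_one]
    exact Submodule.subset_span ⟨d, rfl⟩
  rwa [eval_one_weightHom] at h

lemma IsWeightHomogeneousIdeal.span {w : ι → ℕ} {s : Set (MvPolynomial ι k)}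
    (hs : ∀ g ∈ s, IsWeightHomogeneous w g) : IsWeightHomogeneousIdeal w (Ideal.span s) := by
  have hle : Ideal.span s ≤
      ((Ideal.span s).map (Polynomial.C : MvPolynomial ι k →+* _)).comap
        (weightHom k w).toRingHom := by
    rw [Ideal.span_le]
    intro g hg
    obtain ⟨d, hd⟩ := hs g hg
    have hd' : (weightHom k w).toRingHom g = Polynomial.C g * Polynomial.X ^ d := hd
    rw [SetLike.mem_coe, Ideal.mem_comap, hd']
    exact Ideal.mul_mem_right _ _ (Ideal.mem_map_of_mem _ (Ideal.subset_span hg))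
  intro g hg d
  exact Ideal.mem_map_C_iff.mp (hle hg) d

lemma coeff_zero_weightHom {w : ι → ℕ} (hw : ∀ l, 0 < w l) (g : MvPolynomial ι k) :
    (weightHom k w g).coeff 0 = C (constantCoeff g) := by
  induction g using MvPolynomial.induction_on with
  | C c => rw [← algebraMap_eq, AlgHom.commutes, Polynomial.algebraMap_apply]; simp
  | add p q hp hq => simp [hp, hq]
  | mul_X p l hp => simp [Polynomial.mul_coeff_zero, (hw l).ne]

/-- For a weighted homogeneous ideal, polynomials with nonzero constant term are
nonzerodivisors modulo the ideal. -/
lemma IsWeightHomogeneousIdeal.mem_of_mul_mem {w : ι → ℕ} (hw : ∀ l, 0 < w l)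
    {I : Ideal (MvPolynomial ι k)} (hI : IsWeightHomogeneousIdeal w I)
    {u g : MvPolynomial ι k} (hu : constantCoeff u ≠ 0) (hug : u * g ∈ I) : g ∈ I := by
  let π := Polynomial.mapRingHom (Ideal.Quotient.mk I)
  have hprod : π (weightHom k w u) * π (weightHom k w g) = 0 := by
    rw [← map_mul, ← map_mul]
    ext d
    simp only [π, Polynomial.coe_mapRingHom, Polynomial.coeff_map, Polynomial.coeff_zero]
    exact Ideal.Quotient.eq_zero_iff_mem.mpr (hI _ hug d)
  -- By McCoy, a zero divisor in (R/I)[T] is killed by a nonzero constant; here the coefficient of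
  -- T^0 is a unit because all weights are positive.
  have hreg : π (weightHom k w u) ∈ nonZeroDivisors (Polynomial (MvPolynomial ι k ⧸ I)) := by
    by_contra h
    obtain ⟨c, hc, hc0⟩ := Polynomial.notMem_nonZeroDivisors_iff.mp h
    apply hc
    have h0 := congrArg (fun p => Polynomial.coeff p 0) hc0
    simp only [π, Polynomial.coe_mapRingHom, Polynomial.coeff_smul, Polynomial.coeff_map,
      coeff_zero_weightHom hw, smul_eq_mul, Polynomial.coeff_zero] at h0
    have hunit : IsUnit (Ideal.Quotient.mk I (C (constantCoeff u))) :=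
      ((isUnit_iff_ne_zero.mpr hu).map C).map _
    exact hunit.mul_left_eq_zero.mp h0
  have hg : π (weightHom k w g) = 0 := (mem_nonZeroDivisors_iff.mp hreg).1 _ hprod
  have hcoeff : ∀ d, (weightHom k w g).coeff d ∈ I := fun d => by
    have h0 := congrArg (fun p => Polynomial.coeff p d) hg
    simpa [π, Ideal.Quotient.eq_zero_iff_mem] using h0
  have hle : Submodule.span k (Set.range (weightHom k w g).coeff) ≤ I.restrictScalars k := by
    rw [Submodule.span_le]
    rintro _ ⟨d, rfl⟩
    exact hcoeff d
  exact hle (mem_span_coeff_weightHom w g)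

/-- A weighted homogeneous ideal has a minimal set of weighted homogeneous generators containing
a prescribed weighted homogeneous element that is not in `(x) • I`. -/
theorem IsWeightHomogeneousIdeal.exists_generators [Finite ι] {w : ι → ℕ} (hw : ∀ l, 0 < w l)
    {I : Ideal (MvPolynomial ι k)} (hI : IsWeightHomogeneousIdeal w I)
    {f : MvPolynomial ι k} (hfI : f ∈ I) (hf : IsWeightHomogeneous w f)
    (hfm : f ∉ RingHom.ker (constantCoeff : MvPolynomial ι k →+* k) * I) :
    ∃ fs : List (MvPolynomial ι k), fs.length + 1 ≤ Submodule.spanFinrank I ∧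
      (∀ g ∈ fs, IsWeightHomogeneous w g) ∧ I = Ideal.span {f} ⊔ Ideal.ofList fs := by
  classical
  let m := RingHom.ker (constantCoeff : MvPolynomial ι k →+* k)
  let π : MvPolynomial ι k →ₗ[k] MvPolynomial ι k ⧸ (m * I) :=
    (Ideal.Quotient.mkₐ k (m * I)).toLinearMap
  have hπ : ∀ g, π g = 0 ↔ g ∈ m * I := fun g => Ideal.Quotient.eq_zero_iff_mem
  have hFG : I.FG := IsNoetherian.noetherian I
  let G := Submodule.generators I
  have hGfin : G.Finite := Submodule.FG.finite_generators hFG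
  have hGspan : Ideal.span G = I := Submodule.span_generators I
  have hspanG : ∀ g ∈ I, π g ∈ Submodule.span k (π '' G) := by
    intro g hg
    rw [← hGspan] at hg
    induction hg using Submodule.span_induction with
    | mem x hx => exact Submodule.subset_span ⟨x, hx, rfl⟩
    | zero => simp
    | add x y _ _ hx hy => rw [map_add]; exact add_mem hx hy
    | smul r x hx ih =>
      have hx' : x ∈ I := hGspan ▸ hx
      have : π (r • x) = constantCoeff r • π x := by
        rw [← map_smul, ← sub_eq_zero, ← map_sub, hπ, smul_eq_mul, smul_eq_C_mul, ← sub_mul]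
        exact Ideal.mul_mem_mul (by simp [m, RingHom.mem_ker]) hx'
      rw [this]
      exact Submodule.smul_mem _ _ ih
  let H : Set (MvPolynomial ι k) := {g | g ∈ I ∧ IsWeightHomogeneous w g}
  have hli : LinearIndepOn k id {π f} := by
    rw [linearIndepOn_singleton_iff]
    exact fun h => hfm ((hπ f).mp h)
  -- Extends the class of f to a k-basis of I/mI made of classes of homogeneous elements.
  obtain ⟨b, hbt, hsb, htb, hb⟩ := exists_linearIndepOn_id_extension hli
    (show {π f} ⊆ π '' H by
      rintro _ rfl
      exact ⟨f, ⟨hfI, hf⟩, rfl⟩)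
  have hbG : Submodule.span k b ≤ Submodule.span k (π '' G) := by
    rw [Submodule.span_le]
    intro x hx
    obtain ⟨g, hg, rfl⟩ := hbt hx
    exact hspanG g hg.1
  have : Module.Finite k (Submodule.span k (π '' G)) :=
    Module.Finite.span_of_finite k (hGfin.image π)
  have hb' : LinearIndependent k (fun x : b => (⟨x.1, hbG (Submodule.subset_span x.2)⟩ :
      Submodule.span k (π '' G))) := by
    refine LinearIndependent.of_comp (Submodule.span k (π '' G)).subtype ?_
    exact hb
  have hbfin' : Finite b := hb'.finite
  have hbfin : b.Finite := Set.toFinite b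
  -- A minimal generating set of I spans I/mI over k, since scalars act there through their constant
  -- terms.
  have hbcard : b.ncard ≤ Submodule.spanFinrank I := by
    have := Fintype.ofFinite b
    have h1 := hb'.fintype_card_le_finrank
    rw [← Nat.card_eq_fintype_card, Nat.card_coe_set_eq] at h1
    have := (hGfin.image π).fintype
    refine h1.trans ((finrank_span_le_card (R := k) (π '' G)).trans ?_)
    rw [← Set.ncard_eq_toFinset_card', ← Submodule.FG.generators_ncard hFG]
    exact Set.ncard_image_le hGfin
  choose! σ hσ using fun x (hx : x ∈ b) => hbt hx
  have hfb : π f ∈ b := hsb rfl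
  let fs := (hbfin.toFinset.erase (π f)).toList.map σ
  have hfsI : Ideal.span {f} ⊔ Ideal.ofList fs ≤ I := by
    rw [sup_le_iff, Ideal.span_singleton_le_iff_mem]
    refine ⟨hfI, Ideal.span_le.mpr ?_⟩
    intro g hg
    simp only [fs, Set.mem_ofPred_eq, List.mem_map, Finset.mem_toList, Finset.mem_erase,
      Set.Finite.mem_toFinset] at hg
    obtain ⟨x, hx, rfl⟩ := hg
    exact (hσ x hx.2).1.1
  have hfshom : ∀ g ∈ fs, IsWeightHomogeneous w g := by
    intro g hg
    simp only [fs, List.mem_map, Finset.mem_toList, Finset.mem_erase,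
      Set.Finite.mem_toFinset] at hg
    obtain ⟨x, hx, rfl⟩ := hg
    exact (hσ x hx.2).1.2
  refine ⟨fs, ?_, hfshom, le_antisymm ?_ hfsI⟩
  · rw [List.length_map, Finset.length_toList, Finset.card_erase_add_one (by simpa using hfb),
      ← Set.ncard_eq_toFinset_card _ hbfin]
    exact hbcard
  · have hspan : ∀ x ∈ Submodule.span k b,
        ∃ g ∈ Ideal.span {f} ⊔ Ideal.ofList fs, π g = x := by
      intro x hx
      induction hx using Submodule.span_induction with
      | mem x hx =>
        by_cases hxf : x = π f
        · exact ⟨f, Ideal.mem_sup_left (Ideal.mem_span_singleton_self f), hxf.symm⟩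
        · refine ⟨σ x, Ideal.mem_sup_right (Ideal.subset_span ?_), (hσ x hx).2⟩
          simp only [fs, Set.mem_ofPred_eq, List.mem_map, Finset.mem_toList, Finset.mem_erase,
            Set.Finite.mem_toFinset]
          exact ⟨x, ⟨hxf, hx⟩, rfl⟩
      | zero => exact ⟨0, zero_mem _, map_zero _⟩
      | add x y _ _ hx hy =>
        obtain ⟨g, hg, rfl⟩ := hx
        obtain ⟨g', hg', rfl⟩ := hy
        exact ⟨g + g', add_mem hg hg', map_add _ _ _⟩
      | smul c x _ hx =>
        obtain ⟨g, hg, rfl⟩ := hx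
        exact ⟨c • g, Submodule.smul_of_tower_mem _ c hg, map_smul _ _ _⟩
    have hmem : ∀ g ∈ I, π g ∈ Submodule.span k b := by
      intro g hg
      have hle : Submodule.span k (Set.range (weightHom k w g).coeff) ≤
          (Submodule.span k b).comap π := by
        rw [Submodule.span_le]
        rintro _ ⟨d, rfl⟩
        exact htb ⟨_, ⟨hI g hg d, isWeightHomogeneous_coeff_weightHom w g d⟩, rfl⟩
      exact hle (mem_span_coeff_weightHom w g)
    have hle : I ≤ (Ideal.span {f} ⊔ Ideal.ofList fs) ⊔ m • I := by
      intro g hg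
      obtain ⟨g', hg', h⟩ := hspan _ (hmem g hg)
      have : g - g' ∈ m * I := by rw [← hπ, map_sub, h, sub_self]
      rw [← add_sub_cancel g' g]
      exact add_mem (Ideal.mem_sup_left hg') (Ideal.mem_sup_right this)
    -- The ring is not local, so Nakayama only yields r with constant term 1 carrying I into the
    -- ideal of the lifts; homogeneity of that ideal allows r to be cancelled.
    obtain ⟨r, hr, hrI⟩ := Submodule.exists_sub_one_mem_and_smul_le_of_fg_of_le_sup hFG le_rfl hle
    have hr' : constantCoeff r ≠ 0 := by
      have h := (RingHom.mem_ker).mp hr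
      rw [map_sub, map_one, sub_eq_zero] at h
      rw [h]
      exact one_ne_zero
    have hom : IsWeightHomogeneousIdeal w (Ideal.span {f} ⊔ Ideal.ofList fs) := by
      rw [Ideal.ofList, ← Ideal.span_union]
      refine .span ?_
      rintro g (rfl | hg)
      · exact hf
      · exact hfshom g hg
    intro g hg
    refine hom.mem_of_mul_mem hw hr' (hrI ?_)
    exact Submodule.smul_mem_pointwise_smul _ _ _ hg

end WeightHomogeneous

/-! ### From real cones to natural-number relations. -/

section Cone

/-- Positivity on finitely many reals is an open condition on the values assigned to a ℚ-basis of ℝ.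
It holds at the basis itself, and tuples of rationals are dense. -/
lemma exists_rat_linearMap_pos (F : Finset ℝ) :
    ∃ f : ℝ →ₗ[ℚ] ℚ, ∀ x ∈ F, 0 < x → 0 < f x := by
  let B := Module.Basis.ofVectorSpace ℚ ℝ
  let L : ℝ → (Module.Basis.ofVectorSpaceIndex ℚ ℝ → ℝ) → ℝ := fun x z =>
    ∑ s ∈ (B.repr x).support, (B.repr x s : ℝ) * z s
  have hL : ∀ x, L x (fun s => B s) = x := fun x => by
    conv_rhs => rw [← B.linearCombination_repr x, Finsupp.linearCombination_apply, Finsupp.sum]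
    simp only [L, Rat.smul_def]
  have hcont : ∀ x, Continuous (L x) := fun x => by
    simp only [L]
    fun_prop
  let U : Set (Module.Basis.ofVectorSpaceIndex ℚ ℝ → ℝ) :=
    ⋂ x ∈ F.filter (0 < ·), {z | 0 < L x z}
  have hU : IsOpen U := by
    refine isOpen_biInter_finset fun x _ => ?_
    exact isOpen_lt continuous_const (hcont x)
  have hne : U.Nonempty := by
    refine ⟨fun s => B s, ?_⟩
    simp only [U, Set.mem_iInter, Finset.mem_filter, Set.mem_ofPred_eq, hL]
    exact fun x hx => hx.2
  obtain ⟨_, hzU, z, rfl⟩ := (DenseRange.piMap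
    (fun _ : Module.Basis.ofVectorSpaceIndex ℚ ℝ => Rat.denseRange_cast (𝕜 := ℝ))).inter_open_nonempty
      U hU hne
  refine ⟨B.constr ℚ z, fun x hx hx0 => ?_⟩
  simp only [U, Set.mem_iInter, Finset.mem_filter, Set.mem_ofPred_eq] at hzU
  have h := hzU x ⟨hx, hx0⟩
  have hLx : L x (Pi.map (fun _ => ((↑) : ℚ → ℝ)) z) = ((B.constr ℚ z x : ℚ) : ℝ) := by
    rw [Module.Basis.constr_apply, Finsupp.sum]
    simp [L]
  rw [hLx] at h
  exact_mod_cast h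

lemma exists_nat_mul_eq_natCast (F : Finset ℚ) (hF : ∀ x ∈ F, 0 ≤ x) :
    ∃ N : ℕ, 0 < N ∧ ∀ x ∈ F, ∃ r : ℕ, (N : ℚ) * x = r := by
  refine ⟨∏ x ∈ F, x.den, Finset.prod_pos fun x _ => x.pos, fun x hx => ?_⟩
  obtain ⟨c, hc⟩ := Finset.dvd_prod_of_mem (fun x : ℚ => x.den) hx
  refine ⟨c * x.num.toNat, ?_⟩
  have hn : ((x.num.toNat : ℕ) : ℚ) = x.num := by
    rw [← Int.cast_natCast, Int.toNat_of_nonneg (Rat.num_nonneg.mpr (hF x hx))]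
  rw [hc]
  push_cast
  rw [hn]
  have := Rat.den_mul_eq_num x
  rw [mul_right_comm, this, mul_comm]

variable {ι : Type*} [Fintype ι] {m : ℕ}

lemma mem_closure_image_ne_iff (a : ι → Fin m → ℕ) (i : ι) (y : Fin m → ℕ) :
    y ∈ AddSubmonoid.closure (a '' {t | t ≠ i}) ↔
      ∃ c : ι →₀ ℕ, c i = 0 ∧ ∑ t, c t • a t = y := by
  classical
  constructor
  · intro h
    induction h using AddSubmonoid.closure_induction with
    | mem x hx =>
      obtain ⟨t, ht, rfl⟩ := hx
      refine ⟨Finsupp.single t 1, Finsupp.single_eq_of_ne (Ne.symm ht), ?_⟩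
      simp [Finsupp.single_apply]
    | zero => exact ⟨0, rfl, by simp⟩
    | add x y _ _ hx hy =>
      obtain ⟨c, hc, rfl⟩ := hx
      obtain ⟨d, hd, rfl⟩ := hy
      exact ⟨c + d, by simp [hc, hd], by simp [add_smul, Finset.sum_add_distrib]⟩
  · rintro ⟨c, hc, rfl⟩
    refine sum_mem fun t _ => ?_
    by_cases ht : t = i
    · rw [ht, hc, zero_smul]
      exact zero_mem _
    · exact nsmul_mem (AddSubmonoid.subset_closure (Set.mem_image_of_mem a ht)) _

lemma MemConeOthers.exists_nsmul_mem {a : ι → Fin m → ℕ} {i : ι} (h : MemConeOthers a i) :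
    ∃ b : ℕ, 0 < b ∧ b • a i ∈ AddSubmonoid.closure (a '' {t | t ≠ i}) := by
  classical
  obtain ⟨c, hc0, hci, hc⟩ : ∃ c : ι → ℝ, (∀ t, 0 ≤ c t) ∧ c i = 0 ∧
      ∀ l, (a i l : ℝ) = ∑ t, c t * a t l := by
    have key : ∀ x ∈ PointedCone.hull ℝ
        ((fun t => (fun l => (a t l : ℝ) : Fin m → ℝ)) '' {t | t ≠ i}),
        ∃ c : ι → ℝ, (∀ t, 0 ≤ c t) ∧ c i = 0 ∧ ∀ l, x l = ∑ t, c t * a t l := by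
      intro x h
      induction h using Submodule.span_induction with
      | mem x hx =>
        obtain ⟨t, ht, rfl⟩ := hx
        refine ⟨Pi.single t 1, fun s => ?_, Pi.single_eq_of_ne (Ne.symm ht) _, fun l => ?_⟩
        · by_cases hs : s = t
          · subst hs; simp
          · simp [hs]
        · simp [Pi.single_apply]
      | zero => exact ⟨0, by simp, rfl, by simp⟩
      | add x y _ _ hx hy =>
        obtain ⟨c, hc, hci, hcx⟩ := hx
        obtain ⟨d, hd, hdi, hdy⟩ := hy
        exact ⟨c + d, fun t => add_nonneg (hc t) (hd t), by simp [hci, hdi], fun l => by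
          simp [hcx, hdy, add_mul, Finset.sum_add_distrib]⟩
      | smul r x _ hx =>
        obtain ⟨c, hc, hci, hcx⟩ := hx
        exact ⟨fun t => r * c t, fun t => mul_nonneg r.2 (hc t), by simp [hci], fun l => by
          rw [show (r • x) l = (r : ℝ) * x l from rfl, hcx, Finset.mul_sum]
          simp [mul_assoc]⟩
    exact key _ h
  -- Applying f to the coefficients keeps the relation because the vectors are integral. Including 1
  -- keeps the coefficient of a_i positive; clearing denominators then finishes.
  obtain ⟨f, hf⟩ := exists_rat_linearMap_pos (insert 1 (Finset.univ.image c))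
  have hf1 : 0 < f 1 := hf 1 (by simp) one_pos
  have hfc : ∀ t, 0 ≤ f (c t) := fun t => by
    rcases (hc0 t).eq_or_lt with h0 | h0
    · rw [← h0, map_zero]
    · exact (hf _ (by simp) h0).le
  have hfa : ∀ l, f 1 * (a i l : ℚ) = ∑ t, f (c t) * (a t l : ℚ) := fun l => by
    have hmul : ∀ (x : ℝ) (n : ℕ), f (x * n) = f x * n := fun x n => by
      rw [mul_comm, ← nsmul_eq_mul, map_nsmul, nsmul_eq_mul, mul_comm]
    rw [← hmul, one_mul, hc, map_sum]
    simp [hmul]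
  obtain ⟨N, hN, hNr⟩ := exists_nat_mul_eq_natCast
    (insert (f 1) (Finset.univ.image fun t => f (c t))) (by
      intro x hx
      simp only [Finset.mem_insert, Finset.mem_image, Finset.mem_univ, true_and] at hx
      rcases hx with rfl | ⟨t, rfl⟩
      · exact hf1.le
      · exact hfc t)
  obtain ⟨b, hb⟩ := hNr (f 1) (by simp)
  choose d hd using fun t => hNr (f (c t)) (by simp)
  have hb0 : 0 < b := by
    have : (0 : ℚ) < b := by rw [← hb]; positivity
    exact_mod_cast this
  refine ⟨b, hb0, (mem_closure_image_ne_iff a i _).mpr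
    ⟨Finsupp.equivFunOnFinite.symm d, ?_, ?_⟩⟩
  · have := hd i
    rw [hci, map_zero, mul_zero] at this
    exact_mod_cast this.symm
  · ext l
    have : (∑ t, (d t : ℚ) * a t l) = b * a i l := by
      rw [← hb, mul_assoc, hfa, Finset.mul_sum]
      simp only [← hd, mul_assoc]
    simp only [Finsupp.equivFunOnFinite_symm_apply_apply, Finset.sum_apply, Pi.smul_apply,
      smul_eq_mul]
    exact_mod_cast this

lemma MemConeOthers.critExp_mem {a : ι → Fin m → ℕ} {i : ι} (h : MemConeOthers a i) :
    0 < critExp a i ∧ critExp a i • a i ∈ AddSubmonoid.closure (a '' {t | t ≠ i}) :=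
  Nat.sInf_mem (s := {b : ℕ | 0 < b ∧ b • a i ∈ AddSubmonoid.closure (a '' {t | t ≠ i})})
    h.exists_nsmul_mem

end Cone

/-! ### Pure powers in elements of a toric ideal. -/

section ToricIdeal

open MvPolynomial

variable {k : Type*} [Field k] {ι : Type*} [Fintype ι] {m : ℕ}

lemma aeval_toric_monomial (a : ι → Fin m → ℕ) (u : ι →₀ ℕ) (c : k) :
    aeval (R := k) (fun i => ∏ l : Fin m, (X l : MvPolynomial (Fin m) k) ^ a i l)
      (monomial u c) = monomial (Finsupp.equivFunOnFinite.symm (∑ t, u t • a t)) c := by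
  rw [aeval_monomial, Finsupp.prod_fintype _ _ (by simp), monomial_eq (a := c),
    Finsupp.prod_fintype _ _ (by simp), algebraMap_eq]
  congr 1
  simp only [← Finset.prod_pow, ← pow_mul]
  rw [Finset.prod_comm]
  refine Finset.prod_congr rfl fun l _ => ?_
  rw [Finset.prod_pow_eq_pow_sum]
  simp [mul_comm]

/-- The image of the monomial u has to cancel against that of another monomial of the same degree.
-/
lemma exists_coeff_ne_zero_of_mem_toricIdeal {a : ι → Fin m → ℕ} {f : MvPolynomial ι k}
    (hf : f ∈ toricIdeal k a) {u : ι →₀ ℕ} (hu : coeff u f ≠ 0) :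
    ∃ v, v ≠ u ∧ ∑ t, v t • a t = ∑ t, u t • a t := by
  classical
  by_contra! hcon
  apply hu
  have h := RingHom.mem_ker.mp hf
  have h0 := congrArg (coeff (Finsupp.equivFunOnFinite.symm (∑ t, u t • a t))) h
  rw [f.as_sum] at h0
  rw [map_sum (aeval _), coeff_sum] at h0
  simp only [aeval_toric_monomial, coeff_monomial, coeff_zero,
    EmbeddingLike.apply_eq_iff_eq] at h0
  rw [Finset.sum_eq_single u] at h0
  · simpa using h0
  · intro v _ hv
    rw [if_neg (hcon v hv)]
  · intro hu'
    simpa using hu'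

/-- Cancel the common copies of a_i from the resulting equality of degrees. The other side uses
fewer than b of them, since otherwise a sum of nonzero vectors of ℕ^m would vanish. -/
lemma exists_le_of_coeff_single_ne_zero {a : ι → Fin m → ℕ} (ha : ∀ r, a r ≠ 0)
    {f : MvPolynomial ι k} (hf : f ∈ toricIdeal k a) {i : ι} {b : ℕ}
    (hb : coeff (Finsupp.single i b) f ≠ 0) :
    ∃ b' ≤ b, 0 < b' ∧ b' • a i ∈ AddSubmonoid.closure (a '' {t | t ≠ i}) := by
  classical
  obtain ⟨v, hv, hdeg⟩ := exists_coeff_ne_zero_of_mem_toricIdeal hf hb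
  have hsum : ∑ t, Finsupp.single i b t • a t = b • a i := by
    simp [Finsupp.single_apply]
  have hsplit : ∑ t, v t • a t = v i • a i + ∑ t, v.erase i t • a t := by
    rw [← Finset.add_sum_erase _ _ (Finset.mem_univ i),
      ← Finset.add_sum_erase _ (fun t => v.erase i t • a t) (Finset.mem_univ i)]
    simp only [Finsupp.erase_same, zero_smul, zero_add]
    congr 1
    refine Finset.sum_congr rfl fun t ht => ?_
    rw [Finsupp.erase_ne (Finset.ne_of_mem_erase ht)]
  rw [hsum, hsplit] at hdeg
  have hlt : v i < b := by
    by_contra! hle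
    obtain ⟨d, hd⟩ := Nat.exists_eq_add_of_le hle
    rw [hd, add_smul, add_assoc, add_eq_left] at hdeg
    obtain ⟨h1, h2⟩ := add_eq_zero.mp hdeg
    have hd0 : d = 0 := by
      by_contra hne
      exact ha i ((smul_eq_zero.mp h1).resolve_left hne)
    have hz : ∀ t, v.erase i t = 0 := fun t => by
      by_contra hne
      have := (Finset.sum_eq_zero_iff.mp h2) t (Finset.mem_univ t)
      exact ha t ((smul_eq_zero.mp this).resolve_left hne)
    apply hv
    ext t
    by_cases ht : t = i
    · subst ht; simp [hd, hd0]
    · rw [Finsupp.single_eq_of_ne ht, ← hz t, Finsupp.erase_ne ht]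
  refine ⟨b - v i, Nat.sub_le _ _, Nat.sub_pos_of_lt hlt,
    (mem_closure_image_ne_iff a i _).mpr ⟨v.erase i, Finsupp.erase_same, ?_⟩⟩
  have : (b - v i) • a i + v i • a i = b • a i := by
    rw [← add_smul, Nat.sub_add_cancel hlt.le]
  rw [← this, add_comm] at hdeg
  exact add_right_cancel hdeg

lemma critExp_le_of_coeff_single_ne_zero {a : ι → Fin m → ℕ} (ha : ∀ r, a r ≠ 0)
    {f : MvPolynomial ι k} (hf : f ∈ toricIdeal k a) {i : ι} {b : ℕ}
    (hb : coeff (Finsupp.single i b) f ≠ 0) : critExp a i ≤ b := by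
  obtain ⟨b', hle, hb'⟩ := exists_le_of_coeff_single_ne_zero ha hf hb
  exact (Nat.sInf_le hb').trans hle

/-- In a product r·g with r in (x), this pure power could only come from a strictly smaller pure
power in g, which minimality forbids. It certifies that the binomial is a minimal generator. -/
lemma coeff_single_critExp_eq_zero {a : ι → Fin m → ℕ} (ha : ∀ r, a r ≠ 0) (i : ι)
    {f : MvPolynomial ι k}
    (hf : f ∈ RingHom.ker (constantCoeff : MvPolynomial ι k →+* k) * toricIdeal k a) :
    coeff (Finsupp.single i (critExp a i)) f = 0 := by
  classical
  refine Submodule.mul_induction_on hf (fun r hr g hg => ?_)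
    (fun x y hx hy => by rw [coeff_add, hx, hy, add_zero])
  · rw [coeff_mul]
    refine Finset.sum_eq_zero fun x hx => ?_
    rw [Finsupp.antidiagonal_single, Finset.mem_map] at hx
    obtain ⟨⟨α, β⟩, hαβ, rfl⟩ := hx
    rw [Finset.HasAntidiagonal.mem_antidiagonal] at hαβ
    simp only [Function.Embedding.prodMap, Function.Embedding.coeFn_mk, Prod.map]
    by_cases hβ : coeff (Finsupp.single i β) g = 0
    · erw [hβ, mul_zero]
    · have := critExp_le_of_coeff_single_ne_zero ha hg hβ
      have hα : α = 0 := by simp only at hαβ; omega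
      subst hα
      have hr0 : coeff 0 r = 0 := hr
      simp [hr0]

lemma X_pow_sub_X_pow_mem_toricIdeal {a : ι → Fin m → ℕ} {i j : ι} {q p : ℕ}
    (h : q • a i = p • a j) : (X i ^ q - X j ^ p : MvPolynomial ι k) ∈ toricIdeal k a := by
  classical
  rw [toricIdeal, RingHom.mem_ker, X_pow_eq_monomial, X_pow_eq_monomial, map_sub,
    aeval_toric_monomial, aeval_toric_monomial]
  have hsum : ∀ (i : ι) (b : ℕ), ∑ t, Finsupp.single i b t • a t = b • a i := fun i b => by
    simp [Finsupp.single_apply]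
  rw [hsum, hsum, h, sub_self]

instance toricIdeal_isPrime {ι : Type*} (a : ι → Fin m → ℕ) : (toricIdeal k a).IsPrime :=
  RingHom.ker_isPrime _

lemma X_notMem_toricIdeal {ι : Type*} (a : ι → Fin m → ℕ) (i : ι) : X i ∉ toricIdeal k a := by
  rw [toricIdeal, RingHom.mem_ker, aeval_X, Finset.prod_eq_zero_iff]
  simp [X_ne_zero]

end ToricIdeal

/-! ### Coprimality of the two critical exponents. -/

section GcdVec

lemma Nat.eq_mul_gcd_of_mul_eq_mul {q p x y : ℕ} (hp : 0 < p) (hqp : Nat.Coprime q p)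
    (h : q * x = p * y) : x = p * Nat.gcd x y ∧ y = q * Nat.gcd x y := by
  obtain ⟨z, rfl⟩ : p ∣ x := hqp.symm.dvd_of_dvd_mul_left (Dvd.intro y h.symm)
  have hy : y = q * z := by
    apply Nat.eq_of_mul_eq_mul_left hp
    rw [← h]; ring
  subst hy
  rw [Nat.gcd_mul_right, Nat.gcd_comm, hqp]
  simp

variable {ι : Type*} [Fintype ι] {m : ℕ}

lemma coprime_critExp {a : ι → Fin m → ℕ} {i j : ι} (hij : i ≠ j)
    (hi : MemConeOthers a i) (hm : critExp a i • a i = critExp a j • a j) :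
    Nat.Coprime (critExp a i) (critExp a j) := by
  have hpos := hi.critExp_mem.1
  obtain ⟨g, q, p, hg, hqp, hq, hp⟩ := Nat.exists_coprime' (m := critExp a i) (n := critExp a j)
    (Nat.gcd_pos_of_pos_left _ hpos)
  rw [hq, hp, mul_comm q, mul_comm p, mul_smul, mul_smul] at hm
  have hm' : q • a i = p • a j := smul_right_injective _ hg.ne' hm
  have hq0 : 0 < q := by
    rcases Nat.eq_zero_or_pos q with h | h
    · rw [h, zero_mul] at hq; omega
    · exact h
  -- After cancelling the common factor g, the relation with q still expresses a multiple of a_i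
  -- through a_j, so minimality leaves g = 1.
  have hle : critExp a i ≤ q := Nat.sInf_le ⟨hq0, hm' ▸
    nsmul_mem (AddSubmonoid.subset_closure (Set.mem_image_of_mem a hij.symm)) _⟩
  have hg1 : g = 1 := by
    rw [hq] at hle
    nlinarith
  rw [hq, hp, hg1, mul_one, mul_one]
  exact hqp

lemma eq_smul_gcdVec {u v : Fin m → ℕ} {q p : ℕ} (hp : 0 < p) (hqp : Nat.Coprime q p)
    (h : q • u = p • v) : u = p • gcdVec u v ∧ v = q • gcdVec u v :=
  ⟨funext fun l => (Nat.eq_mul_gcd_of_mul_eq_mul hp hqp (congrFun h l)).1,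
    funext fun l => (Nat.eq_mul_gcd_of_mul_eq_mul hp hqp (congrFun h l)).2⟩

end GcdVec

/-! ### The monomial substitution merging two variables. -/

section FoldHom

open MvPolynomial

/-- The `k`-algebra map `x_l ↦ x_{σ l} ^ (e l)`. -/
noncomputable def foldHom (k : Type*) [Field k] {ι ι' : Type*} (σ : ι → ι') (e : ι → ℕ) :
    MvPolynomial ι k →ₐ[k] MvPolynomial ι' k :=
  aeval fun l => X (σ l) ^ e l

variable {k : Type*} [Field k] {ι ι' : Type*}

@[simp]
lemma foldHom_X (σ : ι → ι') (e : ι → ℕ) (l : ι) :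
    foldHom k σ e (X l) = X (σ l) ^ e l := by
  simp [foldHom]

@[simp]
lemma foldHom_C (σ : ι → ι') (e : ι → ℕ) (c : k) : foldHom k σ e (C c) = C c := by
  simp [foldHom, algebraMap_eq]

lemma constantCoeff_foldHom {σ : ι → ι'} {e : ι → ℕ} (he : ∀ l, 0 < e l)
    (g : MvPolynomial ι k) : constantCoeff (foldHom k σ e g) = constantCoeff g := by
  induction g using MvPolynomial.induction_on with
  | C c => simp
  | add p q hp hq => simp [hp, hq]
  | mul_X p l hp => simp [(he l).ne']

lemma weightHom_foldHom {σ : ι → ι'} {e : ι → ℕ} {w : ι → ℕ} {w' : ι' → ℕ}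
    (hw : ∀ l, w l = e l * w' (σ l)) (g : MvPolynomial ι k) :
    weightHom k w' (foldHom k σ e g) =
      (weightHom k w g).map (foldHom k σ e : MvPolynomial ι k →+* MvPolynomial ι' k) := by
  induction g using MvPolynomial.induction_on with
  | C c =>
    rw [foldHom_C, ← algebraMap_eq, ← algebraMap_eq, AlgHom.commutes, AlgHom.commutes,
      Polynomial.algebraMap_apply, Polynomial.algebraMap_apply]
    simp [algebraMap_eq]
  | add p q hp hq => simp [hp, hq]
  | mul_X p l hp =>
    simp only [map_mul, hp, foldHom_X, map_pow, weightHom_X, Polynomial.map_mul,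
      Polynomial.map_C, Polynomial.map_pow, Polynomial.map_X, RingHom.coe_coe, hw, mul_pow]
    ring

lemma IsWeightHomogeneous.foldHom {σ : ι → ι'} {e : ι → ℕ} {w : ι → ℕ} {w' : ι' → ℕ}
    (hw : ∀ l, w l = e l * w' (σ l)) {g : MvPolynomial ι k} (hg : IsWeightHomogeneous w g) :
    IsWeightHomogeneous w' (foldHom k σ e g) := by
  obtain ⟨d, hd⟩ := hg
  refine ⟨d, ?_⟩
  rw [weightHom_foldHom hw, hd]
  simp

/-- Every target variable has a positive power in the image, hence is integral. -/
lemma foldHom_finite [Finite ι'] {σ : ι → ι'} {e : ι → ℕ} (he : ∀ l, 0 < e l)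
    (hσ : Function.Surjective σ) : (foldHom k σ e).toRingHom.Finite := by
  let := (foldHom k σ e).toRingHom.toAlgebra
  have htower : IsScalarTower k (MvPolynomial ι k) (MvPolynomial ι' k) :=
    IsScalarTower.of_algebraMap_eq fun c => ((foldHom k σ e).commutes c).symm
  have hFT : Algebra.FiniteType (MvPolynomial ι k) (MvPolynomial ι' k) :=
    Algebra.FiniteType.of_restrictScalars_finiteType k _ _
  have hint : Algebra.IsIntegral (MvPolynomial ι k) (MvPolynomial ι' k) := by
    refine ⟨fun g => ?_⟩
    induction g using MvPolynomial.induction_on with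
    | C c =>
      have : (C c : MvPolynomial ι' k) = algebraMap (MvPolynomial ι k) (MvPolynomial ι' k) (C c) :=
        (foldHom_C σ e c).symm
      rw [this]
      exact isIntegral_algebraMap
    | add p q hp hq => exact hp.add hq
    | mul_X p r hp =>
      refine hp.mul ?_
      obtain ⟨l, rfl⟩ := hσ r
      refine IsIntegral.of_pow (he l) ?_
      have : (X (σ l) ^ e l : MvPolynomial ι' k) =
        algebraMap (MvPolynomial ι k) (MvPolynomial ι' k) (X l) := (foldHom_X σ e l).symm
      rw [this]
      exact isIntegral_algebraMap
  exact Algebra.IsIntegral.finite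

lemma isWeaklyRegular_X_pow (L : List ι) (hL : L.Nodup) (d : ι → ℕ) :
    IsWeaklyRegular (MvPolynomial ι k) (L.map fun r => (X r ^ d r : MvPolynomial ι k)) := by
  classical
  refine ⟨fun i hi => ?_⟩
  rw [List.length_map] at hi
  rw [isSMulRegular_quotient_iff_mem_of_smul_mem]
  have hN : (Ideal.ofList (List.take i (L.map fun r => (X r ^ d r : MvPolynomial ι k))) • ⊤ :
      Submodule (MvPolynomial ι k) (MvPolynomial ι k)) =
      Ideal.span ((fun s => monomial s (1 : k)) ''
        ((fun r => Finsupp.single r (d r)) '' {r | r ∈ L.take i})) := by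
    rw [smul_eq_mul, Ideal.mul_top, Ideal.ofList, ← List.map_take]
    congr 1
    ext g
    simp only [Set.mem_ofPred_eq, List.mem_map, Set.mem_image, exists_exists_and_eq_and,
      X_pow_eq_monomial]
  intro g hg
  rw [hN, mem_ideal_span_monomial_image] at hg ⊢
  rw [List.getElem_map, smul_eq_mul, X_pow_eq_monomial] at hg
  intro u hu
  obtain ⟨_, ⟨r, hr, rfl⟩, hle⟩ := hg (Finsupp.single L[i] (d L[i]) + u) (by
    rw [mem_support_iff, coeff_monomial_mul, one_mul]
    exact mem_support_iff.mp hu)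
  refine ⟨_, ⟨r, hr, rfl⟩, ?_⟩
  have hne : L[i] ≠ r := by
    rintro rfl
    obtain ⟨j, hj, hjL⟩ := List.mem_iff_getElem.mp hr
    rw [List.getElem_take] at hjL
    have := (hL.getElem_inj_iff).mp hjL
    rw [List.length_take] at hj
    omega
  rw [Finsupp.single_le_iff] at hle ⊢
  simpa [Finsupp.single_eq_of_ne hne.symm] using hle

end FoldHom

/-! ### Height plus dimension of the quotient. -/

section Dimension

lemma Ideal.height_add_ringKrullDim_quotient_le {R : Type*} [CommRing R] (P : Ideal R)
    [P.IsPrime] : (P.height : WithBot ℕ∞) + ringKrullDim (R ⧸ P) ≤ ringKrullDim R := by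
  let x : PrimeSpectrum R := ⟨P, inferInstance⟩
  have : Nonempty (PrimeSpectrum R) := ⟨x⟩
  have hdim : ringKrullDim (R ⧸ P) = (Order.coheight x : WithBot ℕ∞) := by
    rw [ringKrullDim_quotient, Order.coheight_eq_krullDim_Ici]
    rfl
  rw [hdim, ringKrullDim, Order.krullDim_eq_iSup_height_add_coheight_of_nonempty,
    show P.height = Order.height x from x.height_eq_orderHeight, ← WithBot.coe_add]
  exact WithBot.coe_le_coe.mpr <| le_iSup (fun y : PrimeSpectrum R => Order.height y + Order.coheight y) x

end Dimension

/-! ### Descending membership from a localized module. -/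

section LocalizedModule

variable {R M N : Type*} [CommRing R] [AddCommGroup M] [Module R M] [AddCommGroup N] [Module R N]

lemma IsLocalizedModule.exists_smul_mem_smul_top (T : Submonoid R) (f : M →ₗ[R] N)
    [IsLocalizedModule T f] {I : Ideal R} {x : M} (hx : f x ∈ (I • ⊤ : Submodule R N)) :
    ∃ u ∈ T, u • x ∈ (I • ⊤ : Submodule R M) := by
  have key : ∀ z ∈ (I • ⊤ : Submodule R N),
      ∃ u ∈ T, ∃ y ∈ (I • ⊤ : Submodule R M), u • z = f y := by
    intro z hz
    refine Submodule.smul_induction_on hz (fun r hr n _ => ?_) (fun z z' hz hz' => ?_)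
    · obtain ⟨⟨y, u⟩, hy⟩ := IsLocalizedModule.surj T f n
      refine ⟨u, u.2, r • y, Submodule.smul_mem_smul hr trivial, ?_⟩
      rw [map_smul, ← hy, smul_comm]
      rfl
    · obtain ⟨u, hu, y, hy, h⟩ := hz
      obtain ⟨u', hu', y', hy', h'⟩ := hz'
      refine ⟨u * u', mul_mem hu hu', u' • y + u • y',
        add_mem (Submodule.smul_mem _ _ hy) (Submodule.smul_mem _ _ hy'), ?_⟩
      rw [map_add, map_smul, map_smul, ← h, ← h', smul_add, smul_smul, smul_smul, mul_comm u' u]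
  obtain ⟨u, hu, y, hy, h⟩ := key _ hx
  rw [← map_smul] at h
  obtain ⟨c, hc⟩ := IsLocalizedModule.exists_of_eq (S := T) h
  refine ⟨c * u, mul_mem c.2 hu, ?_⟩
  rw [mul_smul, ← Submonoid.smul_def, hc]
  exact Submodule.smul_mem _ _ hy

end LocalizedModule

/-! ### Regular sequences through the substitution, and generators of the upper prime. -/

section FoldRegular

open MvPolynomial

universe u v

variable {k : Type u} {ι ι' : Type v} [Field k]

/-- The support of M/IM lies in V(I + Ann M), and Spec A embeds in Spec R. Allowing Ann M lets
generators that act as zero count towards K. -/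
lemma supportDim_quotient_smul_top_le {R A M : Type*} [CommRing R] [CommRing A] [Algebra R A]
    (T : Submonoid R) [IsLocalization T A] [AddCommGroup M] [Module A M] {I : Ideal A} {K : Ideal R}
    (hK : K ≤ (I ⊔ Module.annihilator A M).comap (algebraMap R A)) :
    Module.supportDim A (M ⧸ (I • ⊤ : Submodule A M)) ≤ ringKrullDim (R ⧸ K) := by
  rw [ringKrullDim_quotient, Module.supportDim]
  have hann : ∀ q ∈ Module.support A (M ⧸ (I • ⊤ : Submodule A M)),
      I ⊔ Module.annihilator A M ≤ q.asIdeal := by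
    intro q hq
    have h := Module.annihilator_le_of_mem_support hq
    refine le_trans (sup_le (fun r hr => ?_) (fun r hr => ?_)) h
    · rw [Module.mem_annihilator]
      rintro ⟨y⟩
      exact (Submodule.Quotient.mk_eq_zero _).mpr (Submodule.smul_mem_smul hr trivial)
    · rw [Module.mem_annihilator] at hr ⊢
      rintro ⟨y⟩
      refine (Submodule.Quotient.mk_eq_zero _).mpr ?_
      have h0 : r • y = 0 := hr y
      change r • y ∈ _
      rw [h0]
      exact zero_mem _
  refine Order.krullDim_le_of_strictMono
    (fun q => ⟨PrimeSpectrum.comap (algebraMap R A) q.1, fun r hr =>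
      hann q.1 q.2 (hK hr)⟩ : Module.support A (M ⧸ (I • ⊤ : Submodule A M)) →
        PrimeSpectrum.zeroLocus (K : Set R)) ?_
  refine Monotone.strictMono_of_injective (fun a b h => ?_) (fun a b h => ?_)
  · exact Ideal.comap_mono (f := algebraMap R A) h
  · apply Subtype.ext
    exact PrimeSpectrum.localization_comap_injective A T (congrArg Subtype.val h)

/-- If a prime `p` of the source of `foldHom` is generated by an element of the kernel of `foldHom`
and `ht p - 1` further weighted homogeneous elements, then these and any element outside of `p`
form a regular sequence in the target. -/
theorem isWeaklyRegular_map_foldHom [Finite ι] [Finite ι'] {σ : ι → ι'} {e : ι → ℕ}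
    (he : ∀ l, 0 < e l) (hσ : Function.Surjective σ) (hcard : Nat.card ι = Nat.card ι' + 1)
    {w' : ι' → ℕ} (hw' : ∀ l, 0 < w' l)
    {p : Ideal (MvPolynomial ι k)} [p.IsPrime]
    (hpm : p ≤ RingHom.ker (constantCoeff : MvPolynomial ι k →+* k))
    {f : MvPolynomial ι k} (hf : foldHom k σ e f = 0) {fs : List (MvPolynomial ι k)}
    (hfs : ∀ g ∈ fs, IsWeightHomogeneous w' (foldHom k σ e g))
    (hp : p = Ideal.span {f} ⊔ Ideal.ofList fs) (hlen : (fs.length + 1 : ℕ) ≤ p.height)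
    {x : MvPolynomial ι k} (hxm : constantCoeff x = 0) (hxp : x ∉ p) :
    IsWeaklyRegular (MvPolynomial ι' k) ((fs ++ [x]).map (foldHom k σ e)) := by
  classical
  have := Fintype.ofFinite ι'
  let φ := foldHom k σ e
  let := φ.toRingHom.toAlgebra
  have hφ : ∀ g, algebraMap (MvPolynomial ι k) (MvPolynomial ι' k) g = φ g := fun _ => rfl
  have hfin : Module.Finite (MvPolynomial ι k) (MvPolynomial ι' k) := foldHom_finite he hσ
  let m := RingHom.ker (constantCoeff : MvPolynomial ι k →+* k)
  have hm : m.IsPrime := RingHom.ker_isPrime _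
  let A := Localization.AtPrime m
  let M := LocalizedModule m.primeCompl (MvPolynomial ι' k)
  let F : MvPolynomial ι' k →ₗ[MvPolynomial ι k] M := LocalizedModule.mkLinearMap _ _
  have hMfin : Module.Finite A M := Module.Finite.of_isLocalizedModule m.primeCompl F
  have hu : ∀ u ∈ m.primeCompl, constantCoeff (φ u) ≠ 0 := fun u hu => by
    rw [constantCoeff_foldHom he]
    exact hu
  have hMnt : Nontrivial M := by
    refine ⟨F 1, 0, fun h => ?_⟩
    rw [← F.map_zero] at h
    obtain ⟨u, h⟩ := IsLocalizedModule.exists_of_eq (S := m.primeCompl) h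
    rw [smul_zero, Submonoid.smul_def, Algebra.smul_def, mul_one] at h
    have h0 := hu u u.2
    rw [← hφ, h, map_zero] at h0
    exact h0 rfl
  have hmax : ∀ g ∈ m, algebraMap (MvPolynomial ι k) A g ∈ maximalIdeal A := fun g hg => by
    rw [← Localization.AtPrime.map_eq_maximalIdeal]
    exact Ideal.mem_map_of_mem _ hg
  obtain ⟨ρ, hρ⟩ := hσ.hasRightInverse
  -- One source variable over each target variable: they act as powers of the distinct target
  -- variables, giving a regular sequence of the full length `Nat.card ι'`.
  let rs : List (MvPolynomial ι k) := Finset.univ.toList.map fun r => X (ρ r)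
  have hrslen : rs.length = Nat.card ι' := by simp [rs]
  have hrsm : ∀ r ∈ rs, r ∈ m := by
    intro r hr
    obtain ⟨s, -, rfl⟩ := List.mem_map.mp hr
    simp [m, RingHom.mem_ker]
  have hrs : IsRegular M (rs.map (algebraMap _ A)) := by
    refine IsWeaklyRegular.isRegular_of_isLocalizedModule_of_mem A m F ?_ hrsm
    rw [← isWeaklyRegular_map_algebraMap_iff (MvPolynomial ι' k)]
    have : rs.map (algebraMap (MvPolynomial ι k) (MvPolynomial ι' k)) =
        Finset.univ.toList.map fun r => X r ^ e (ρ r) := by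
      rw [List.map_map]
      refine List.map_congr_left fun r _ => ?_
      rw [Function.comp_apply, hφ, foldHom_X, hρ]
    rw [this]
    exact isWeaklyRegular_X_pow _ (Finset.nodup_toList _) _
  have hfp : f ∈ p := hp ▸ Ideal.mem_sup_left (Ideal.mem_span_singleton_self f)
  have hfsp : ∀ g ∈ fs, g ∈ p := fun g hg => hp ▸ Ideal.mem_sup_right (Ideal.subset_span hg)
  -- Since f kills M, the dimension of M/(fs, x)M is at most dim R/(p + (x)) ≤ dim R/p − 1, and dim
  -- R/p ≤ `Nat.card ι` − ht p.
  have hdim : Module.supportDim A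
      (M ⧸ (Ideal.ofList ((fs ++ [x]).map (algebraMap _ A)) • ⊤ : Submodule A M)) +
        ((fs ++ [x]).map (algebraMap _ A)).length ≤ (rs.map (algebraMap _ A)).length := by
    have h1 := supportDim_quotient_smul_top_le (A := A) (M := M)
      (I := Ideal.ofList ((fs ++ [x]).map (algebraMap _ A))) (K := p ⊔ Ideal.span {x})
      m.primeCompl (by
        rw [hp, sup_le_iff, sup_le_iff, Ideal.span_singleton_le_iff_mem,
          Ideal.span_singleton_le_iff_mem]
        refine ⟨⟨?_, Ideal.span_le.mpr fun g hg => ?_⟩, ?_⟩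
        · refine Ideal.mem_sup_right ?_
          rw [Module.mem_annihilator]
          intro y
          obtain ⟨⟨z, s⟩, hz⟩ := IsLocalizedModule.surj m.primeCompl F y
          rw [algebraMap_smul]
          have h0 : (s : MvPolynomial ι k) • (f • y) = 0 := by
            have hz' : (s : MvPolynomial ι k) • y = F z := hz
            rw [smul_comm, hz', ← map_smul, Algebra.smul_def, hφ, hf, zero_mul, map_zero]
          exact (IsLocalizedModule.smul_inj F s _ _).mp (by
            rw [smul_zero]; exact h0)
        · exact Ideal.mem_sup_left (Ideal.subset_span (List.mem_map_of_mem
            (List.mem_append_left _ hg)))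
        · exact Ideal.mem_sup_left (Ideal.subset_span (List.mem_map_of_mem
            (List.mem_append_right _ (List.mem_singleton_self x)))))
    have hle : p ≤ p ⊔ Ideal.span {x} := le_sup_left
    have h2 := ringKrullDim_succ_le_of_surjective (Ideal.Quotient.factor hle)
      (Ideal.Quotient.factor_surjective hle) (r := Ideal.Quotient.mk p x)
      (mem_nonZeroDivisors_of_ne_zero (by rwa [Ne, Ideal.Quotient.eq_zero_iff_mem]))
      (by
        rw [Ideal.Quotient.factor_mk, Ideal.Quotient.eq_zero_iff_mem]
        exact Ideal.mem_sup_right (Ideal.mem_span_singleton_self x))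
    have h3 := Ideal.height_add_ringKrullDim_quotient_le p
    rw [MvPolynomial.ringKrullDim_of_isNoetherianRing, ringKrullDim_eq_zero_of_field, zero_add,
      hcard] at h3
    rw [List.length_map, List.length_map, hrslen, List.length_append, List.length_singleton]
    have h4 := (add_le_add_left h1 1).trans h2
    have h5 : ((fs.length + 1 : ℕ) : WithBot ℕ∞) ≤ p.height := by exact_mod_cast hlen
    have h6 := (add_le_add h5 h4).trans h3
    generalize Module.supportDim A
      (M ⧸ (Ideal.ofList ((fs ++ [x]).map (algebraMap _ A)) • ⊤ : Submodule A M)) = D at h6 ⊢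
    induction D with
    | bot => simp
    | coe D =>
      have h7 : ((fs.length + 1 : ℕ) : ℕ∞) + (D + 1) ≤ ((Nat.card ι' + 1 : ℕ) : ℕ∞) := by
        exact_mod_cast h6
      have h8 : D + ((fs.length + 1 : ℕ) : ℕ∞) + 1 ≤ (Nat.card ι' : ℕ∞) + 1 := by
        refine le_trans (le_of_eq ?_) (h7.trans (le_of_eq ?_))
        · ring
        · push_cast; rfl
      exact_mod_cast (ENat.add_le_add_iff_right ENat.one_ne_top).mp h8
  have hxs : ∀ g ∈ fs ++ [x], g ∈ m := by
    intro g hg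
    rcases List.mem_append.mp hg with hg | hg
    · exact hpm (hfsp g hg)
    · rw [List.mem_singleton.mp hg]
      exact hxm
  have hregM : IsWeaklyRegular M (fs ++ [x]) := by
    rw [← isWeaklyRegular_map_algebraMap_iff A]
    refine isWeaklyRegular_of_supportDim_add_length_le _ ?_ (fun r hr => ?_) hrs hdim
    · intro r hr
      obtain ⟨g, hg, rfl⟩ := List.mem_map.mp hr
      exact hmax g (hxs g hg)
    · obtain ⟨g, hg, rfl⟩ := List.mem_map.mp hr
      exact hmax g (hrsm g hg)
  -- Regularity at the origin globalizes: the denominators u have nonzero constant term, so they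
  -- cancel modulo the homogeneous ideals generated by initial segments of `fs`. Only these segments
  -- need be homogeneous, as x comes last.
  have hregS : IsWeaklyRegular (MvPolynomial ι' k) (fs ++ [x]) := by
    refine ⟨fun i hi => ?_⟩
    have h := hregM.regular_mod_prev i hi
    rw [isSMulRegular_quotient_iff_mem_of_smul_mem] at h ⊢
    have hi' : i ≤ fs.length := by
      rw [List.length_append, List.length_singleton] at hi
      omega
    have htake : (fs ++ [x]).take i = fs.take i := List.take_append_of_le_length hi'
    rw [htake] at h ⊢
    intro g hg
    have hmap : ∀ y ∈ (Ideal.ofList (fs.take i) • ⊤ : Submodule (MvPolynomial ι k) (MvPolynomial ι' k)),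
        F y ∈ (Ideal.ofList (fs.take i) • ⊤ : Submodule (MvPolynomial ι k) M) := by
      intro y hy
      have h1 := Submodule.mem_map_of_mem (f := F) hy
      rw [Submodule.map_smul''] at h1
      exact Submodule.smul_mono le_rfl le_top h1
    have h1 := hmap _ hg
    rw [map_smul] at h1
    obtain ⟨u, hum, hug⟩ := IsLocalizedModule.exists_smul_mem_smul_top m.primeCompl F (h _ h1)
    rw [Ideal.smul_top_eq_map, Submodule.restrictScalars_mem] at hug ⊢
    rw [Algebra.smul_def] at hug
    refine IsWeightHomogeneousIdeal.mem_of_mul_mem hw' ?_ (hu u hum) hug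
    rw [Ideal.map_ofList]
    refine .span fun y hy => ?_
    obtain ⟨z, hz, rfl⟩ := List.mem_map.mp hy
    exact hfs z (List.mem_of_mem_take hz)
  exact (isWeaklyRegular_map_algebraMap_iff _ _ _).mpr hregS

/-- In the situation of `isWeaklyRegular_map_foldHom`, a prime lying over `p` is generated by the
images of the homogeneous generators of `p`, and these are a minimal number of generators. -/
theorem eq_map_and_height_of_comap_foldHom_eq [Finite ι] [Finite ι'] {σ : ι → ι'} {e : ι → ℕ}
    (he : ∀ l, 0 < e l) (hσ : Function.Surjective σ) (hcard : Nat.card ι = Nat.card ι' + 1)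
    {w' : ι' → ℕ} (hw' : ∀ l, 0 < w' l)
    {P : Ideal (MvPolynomial ι' k)} [P.IsPrime] {p : Ideal (MvPolynomial ι k)} [p.IsPrime]
    (hPp : P.comap (foldHom k σ e) = p)
    (hpm : p ≤ RingHom.ker (constantCoeff : MvPolynomial ι k →+* k))
    {f : MvPolynomial ι k} (hf : foldHom k σ e f = 0) {fs : List (MvPolynomial ι k)}
    (hfs : ∀ g ∈ fs, IsWeightHomogeneous w' (foldHom k σ e g))
    (hp : p = Ideal.span {f} ⊔ Ideal.ofList fs) (hlen : (fs.length + 1 : ℕ) ≤ p.height)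
    {x : MvPolynomial ι k} (hxm : constantCoeff x = 0) (hxp : x ∉ p)
    (hcond : ∀ g, ∃ N, foldHom k σ e x ^ N * g ∈ (foldHom k σ e).range) :
    P = p.map (foldHom k σ e) ∧ (Submodule.spanFinrank P : ℕ∞) = P.height ∧
      P.height + 1 = p.height := by
  classical
  have hreg := isWeaklyRegular_map_foldHom he hσ hcard hw' hpm hf hfs hp hlen hxm hxp
  rw [List.map_append, isWeaklyRegular_append_iff] at hreg
  obtain ⟨hreg, hxreg⟩ := hreg
  let φ := foldHom k σ e
  let L := fs.map φ
  have hmap : p.map φ = Ideal.ofList L := by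
    have h1 : Ideal.map φ (Ideal.span {f}) = ⊥ := by
      rw [Ideal.map_span, Set.image_singleton, show φ f = 0 from hf]
      exact Ideal.span_singleton_eq_bot.mpr rfl
    have h2 : Ideal.map φ (Ideal.ofList fs) = Ideal.ofList L :=
      Ideal.map_ofList φ.toRingHom fs
    rw [hp, Ideal.map_sup, h1, h2, bot_sup_eq]
  have hmapP : p.map φ ≤ P := Ideal.map_le_iff_le_comap.mpr hPp.ge
  have hxreg' : IsSMulRegular (MvPolynomial ι' k ⧸
      (Ideal.ofList L • ⊤ : Submodule (MvPolynomial ι' k) (MvPolynomial ι' k))) (φ x) := by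
    rw [List.map_singleton, isWeaklyRegular_singleton_iff] at hxreg
    exact hxreg
  -- A power of φ(x) moves g ∈ P into the image of φ, hence into the extension of p; φ(x) is a
  -- nonzerodivisor modulo that extension.
  have hP : P = p.map φ := by
    refine le_antisymm (fun g hg => ?_) hmapP
    obtain ⟨N, r, hr⟩ := hcond g
    have hr' : φ r = φ x ^ N * g := hr
    have hrp : r ∈ p := by
      rw [← hPp, Ideal.mem_comap]
      change φ r ∈ P
      rw [hr']
      exact Ideal.mul_mem_left _ _ hg
    have h1 : φ x ^ N • g ∈ (Ideal.ofList L • ⊤ : Submodule (MvPolynomial ι' k) _) := by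
      rw [smul_eq_mul, smul_eq_mul, Ideal.mul_top, ← hmap, ← hr']
      exact Ideal.mem_map_of_mem _ hrp
    have h2 := hxreg'.pow N
    rw [isSMulRegular_quotient_iff_mem_of_smul_mem] at h2
    replace h2 := h2 _ h1
    rwa [smul_eq_mul, Ideal.mul_top, ← hmap] at h2
  have hlenL : L.length = fs.length := List.length_map _
  have hspan : Submodule.spanFinrank P ≤ fs.length := by
    rw [hP, hmap, ← hlenL]
    have hset : {r | r ∈ L} = (L.toFinset : Set (MvPolynomial ι' k)) := by ext; simp
    rw [Ideal.ofList, hset]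
    refine (Submodule.spanFinrank_span_le_ncard_of_finite (Finset.finite_toSet _)).trans ?_
    rw [Set.ncard_coe_finset]
    exact List.toFinset_card_le L
  -- The images of `fs` stay regular in the localization at P, so its dimension is at least their
  -- number.
  have hht : (fs.length : ℕ∞) ≤ P.height := by
    have hr := hreg.isRegular_of_isLocalization_of_mem (Localization.AtPrime P) P (fun g hg => by
      refine hmapP ?_
      rw [hmap]
      exact Ideal.subset_span hg)
    have hd := ringKrullDim_add_length_eq_ringKrullDim_of_isRegular _ hr
    rw [IsLocalization.AtPrime.ringKrullDim_eq_height P (Localization.AtPrime P)] at hd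
    have hnt := hr.quot_ofList_smul_nontrivial ⊤
    rw [smul_eq_mul, Ideal.mul_top] at hnt
    have h0 := ringKrullDim_nonneg_of_nontrivial (R := Localization.AtPrime P ⧸
      Ideal.ofList (L.map (algebraMap _ (Localization.AtPrime P))))
    have h1 := add_le_add_left h0
      ((L.map (algebraMap _ (Localization.AtPrime P))).length : WithBot ℕ∞)
    rw [zero_add] at h1
    have h2 := h1.trans hd.le
    rw [List.length_map, hlenL] at h2
    exact_mod_cast h2
  have hKrull := Ideal.height_le_spanFinrank P Ideal.IsPrime.ne_top'
  have hspan' : (Submodule.spanFinrank P : ℕ∞) ≤ fs.length := by exact_mod_cast hspan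
  have hPht : P.height = fs.length := le_antisymm (hKrull.trans hspan') hht
  have hpht : p.height ≤ (fs.length + 1 : ℕ) := by
    refine (Ideal.height_le_spanFinrank p Ideal.IsPrime.ne_top').trans ?_
    have hset : Ideal.span {f} ⊔ Ideal.ofList fs =
        Ideal.span ((insert f fs.toFinset : Finset (MvPolynomial ι k)) : Set _) := by
      rw [Ideal.ofList, ← Ideal.span_union]
      congr 1
      ext
      simp
    rw [hp, hset]
    have h1 := Submodule.spanFinrank_span_le_ncard_of_finite (R := MvPolynomial ι k)
      (Finset.finite_toSet (insert f fs.toFinset))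
    rw [Set.ncard_coe_finset] at h1
    have h2 := (h1.trans (Finset.card_insert_le _ _)).trans
      (Nat.add_le_add_right (List.toFinset_card_le fs) 1)
    exact_mod_cast h2
  refine ⟨hP, le_antisymm (hspan'.trans hht) hKrull, ?_⟩
  rw [hPht, le_antisymm hpht hlen]
  push_cast
  rfl

end FoldRegular

/-! ### Toric ideals, critical exponents and cones under the substitution. -/

section ToricFold

open MvPolynomial

variable {k : Type*} [Field k] {ι ι' : Type*} {m : ℕ}

lemma weightHom_aeval_toric (a : ι → Fin m → ℕ) (g : MvPolynomial ι k) :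
    weightHom k (fun _ => 1)
      (aeval (R := k) (fun i => ∏ l : Fin m, (X l : MvPolynomial (Fin m) k) ^ a i l) g) =
    (weightHom k (fun i => ∑ l, a i l) g).map
      (aeval (R := k) (fun i => ∏ l : Fin m, (X l : MvPolynomial (Fin m) k) ^ a i l) :
        MvPolynomial ι k →+* MvPolynomial (Fin m) k) := by
  induction g using MvPolynomial.induction_on with
  | C c =>
    rw [← algebraMap_eq, AlgHom.commutes, AlgHom.commutes, AlgHom.commutes,
      Polynomial.algebraMap_apply, Polynomial.algebraMap_apply, Polynomial.map_C]
    simp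
  | add p q hp hq => simp only [map_add, hp, hq, Polynomial.map_add]
  | mul_X p i hp =>
    simp only [map_mul, hp, Polynomial.map_mul, weightHom_X, Polynomial.map_C, Polynomial.map_pow,
      Polynomial.map_X, RingHom.coe_coe, aeval_X, map_prod, map_pow, pow_one, mul_pow,
      Finset.prod_mul_distrib, Finset.prod_pow_eq_pow_sum]

lemma isWeightHomogeneousIdeal_toricIdeal (a : ι → Fin m → ℕ) :
    IsWeightHomogeneousIdeal (fun i => ∑ l, a i l) (toricIdeal k a) := by
  intro g hg d
  have hg' := RingHom.mem_ker.mp hg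
  refine RingHom.mem_ker.mpr ?_
  have h := congrArg (fun q => Polynomial.coeff q d) (weightHom_aeval_toric a g)
  simp only [Polynomial.coeff_map] at h
  refine h.symm.trans ?_
  rw [show aeval (R := k) (fun i => ∏ l : Fin m, (X l : MvPolynomial (Fin m) k) ^ a i l) g = 0
    from hg', map_zero, Polynomial.coeff_zero]

lemma comap_foldHom_toricIdeal {σ : ι → ι'} {e : ι → ℕ} {a : ι → Fin m → ℕ}
    {a' : ι' → Fin m → ℕ} (ha : ∀ l, a l = e l • a' (σ l)) :
    (toricIdeal k a').comap (foldHom k σ e) = toricIdeal k a := by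
  have h : (aeval (R := k) (fun i => ∏ l : Fin m, (X l : MvPolynomial (Fin m) k) ^ a' i l)).comp
      (foldHom k σ e) =
      aeval (R := k) (fun i => ∏ l : Fin m, (X l : MvPolynomial (Fin m) k) ^ a i l) := by
    ext1 l
    rw [AlgHom.comp_apply, foldHom_X, map_pow, aeval_X, aeval_X, ← Finset.prod_pow]
    simp [ha l, ← pow_mul, mul_comm]
  ext g
  exact iff_of_eq (congrArg (· = 0) (DFunLike.congr_fun h g))

lemma toricIdeal_le_ker_constantCoeff [Fintype ι] [Nonempty ι] {a : ι → Fin m → ℕ}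
    (ha : ∀ r, a r ≠ 0) :
    toricIdeal k a ≤ RingHom.ker (constantCoeff : MvPolynomial ι k →+* k) := by
  intro f hf
  by_contra h
  obtain ⟨i⟩ := ‹Nonempty ι›
  have h' : coeff (Finsupp.single i 0) f ≠ 0 := by
    rw [Finsupp.single_zero]
    exact h
  obtain ⟨b, hb, hb0, -⟩ := exists_le_of_coeff_single_ne_zero ha hf h'
  omega

lemma Nat.Coprime.exists_mul_add_one_eq_mul {p q : ℕ} (hp : 0 < p) (hq : 0 < q)
    (h : Nat.Coprime p q) : ∃ N b, p * N + 1 = q * b := by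
  obtain ⟨z, hzp, hzq⟩ := Nat.chineseRemainder h 1 0
  -- Adding p·q preserves both congruences and excludes z = 0, so subtracting 1 is not truncated.
  have h1 : 1 ≤ z + p * q := by nlinarith [Nat.mul_pos hp hq]
  have h2 : 1 ≡ z + p * q [MOD p] := by
    simpa [Nat.ModEq] using hzp.symm
  obtain ⟨N, hN⟩ := (Nat.modEq_iff_dvd' h1).mp h2
  obtain ⟨b, hb⟩ := (Nat.modEq_zero_iff_dvd.mp hzq)
  refine ⟨N, b + p, ?_⟩
  rw [← hN, Nat.sub_add_cancel h1, hb]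
  ring

/-- The merged variable y is the only one missing from the image. From e_i·N + 1 = e_j·b one gets
φ(x_i)^N·y = φ(x_j)^b. -/
lemma exists_pow_mul_mem_range_foldHom {σ : ι → ι'} {e : ι → ℕ} {i j : ι}
    (hi : 0 < e i) (hj : 0 < e j) (hσ : σ i = σ j) (hcop : Nat.Coprime (e i) (e j))
    (hσe : ∀ r, r ≠ σ i → ∃ l, σ l = r ∧ e l = 1) (g : MvPolynomial ι' k) :
    ∃ N, foldHom k σ e (X i) ^ N * g ∈ (foldHom k σ e).range := by
  induction g using MvPolynomial.induction_on with
  | C c => exact ⟨0, C c, by simp⟩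
  | add p q hp hq =>
    obtain ⟨N, r, hr⟩ := hp
    obtain ⟨N', r', hr'⟩ := hq
    refine ⟨N + N', X i ^ N' * r + X i ^ N * r', ?_⟩
    change foldHom k σ e _ = _
    have hr : foldHom k σ e r = _ := hr
    have hr' : foldHom k σ e r' = _ := hr'
    rw [map_add, map_mul, map_mul, hr, hr', map_pow, map_pow]
    ring
  | mul_X p s hp =>
    obtain ⟨N, r, hr⟩ := hp
    have hr : foldHom k σ e r = _ := hr
    by_cases hs : s = σ i
    · obtain ⟨N', b, hb⟩ := hcop.exists_mul_add_one_eq_mul hi hj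
      refine ⟨N + N', r * X j ^ b, ?_⟩
      change foldHom k σ e _ = _
      rw [map_mul, hr, map_pow, foldHom_X, foldHom_X, ← hσ, hs, ← pow_mul (X (σ i)) (e j), ← hb]
      ring
    · obtain ⟨l, rfl, hl⟩ := hσe s hs
      refine ⟨N, r * X l, ?_⟩
      change foldHom k σ e _ = _
      rw [map_mul, hr, foldHom_X, foldHom_X, hl]
      ring

/-- As s is alone in its fibre and all exponents are positive, a monomial maps to a pure power of
this variable only if it is one of x_s. -/
lemma coeff_single_foldHom [Fintype ι] {σ : ι → ι'} {e : ι → ℕ} (he : ∀ l, 0 < e l) {s : ι}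
    (hes : e s = 1) (hs : ∀ l, σ l = σ s → l = s) (b : ℕ) (f : MvPolynomial ι k) :
    coeff (Finsupp.single (σ s) b) (foldHom k σ e f) = coeff (Finsupp.single s b) f := by
  classical
  induction f using MvPolynomial.induction_on' with
  | monomial u c =>
    let D : ι' →₀ ℕ := ∑ l, Finsupp.single (σ l) (e l * u l)
    have hmon : foldHom k σ e (monomial u c) = monomial D c := by
      rw [foldHom, aeval_monomial, Finsupp.prod_fintype _ _ (by simp), algebraMap_eq]
      have hpow : ∀ l, ((X (σ l) : MvPolynomial ι' k) ^ e l) ^ u l =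
          monomial (Finsupp.single (σ l) (e l * u l)) 1 := fun l => by
        rw [← pow_mul, X_pow_eq_monomial]
      simp only [hpow]
      rw [← monomial_sum_one, C_mul_monomial, mul_one]
    have hD : D = Finsupp.single (σ s) b ↔ u = Finsupp.single s b := by
      have hDl : ∀ t, D t = ∑ l, if σ l = t then e l * u l else 0 := fun t => by
        simp only [D, Finsupp.finsetSum_apply, Finsupp.single_apply]
      constructor
      · intro h
        have hDs : D (σ s) = u s := by
          rw [hDl, Finset.sum_eq_single s]
          · simp [hes]
          · intro l _ hl
            rw [if_neg fun h => hl (hs l h)]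
          · simp
        ext l
        by_cases hl : l = s
        · subst hl
          rw [← hDs, h]
          simp
        · have h0 : D (σ l) = 0 := by
            rw [h, Finsupp.single_eq_of_ne]
            exact fun h => hl (hs l h)
          rw [hDl, Finset.sum_eq_zero_iff] at h0
          have := h0 l (Finset.mem_univ l)
          rw [if_pos rfl, mul_eq_zero] at this
          rw [Finsupp.single_eq_of_ne hl]
          exact this.resolve_left (he l).ne'
      · rintro rfl
        simp only [D]
        rw [Finset.sum_eq_single s]
        · simp [hes]
        · intro l _ hl
          rw [Finsupp.single_eq_of_ne hl, mul_zero, Finsupp.single_zero]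
        · simp
    rw [hmon, coeff_monomial, coeff_monomial]
    exact if_congr hD rfl rfl
  | add p q hp hq => rw [map_add, coeff_add, coeff_add, hp, hq]

lemma exists_coeff_single_ne_zero_of_mem_map_foldHom [Fintype ι] {σ : ι → ι'} {e : ι → ℕ}
    (he : ∀ l, 0 < e l) {s : ι} (hes : e s = 1) (hs : ∀ l, σ l = σ s → l = s)
    {I : Ideal (MvPolynomial ι k)} {g : MvPolynomial ι' k} (hg : g ∈ I.map (foldHom k σ e))
    {b : ℕ} (hb : coeff (Finsupp.single (σ s) b) g ≠ 0) :
    ∃ f ∈ I, ∃ b' ≤ b, coeff (Finsupp.single s b') f ≠ 0 := by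
  classical
  rw [Ideal.map] at hg
  induction hg using Submodule.span_induction generalizing b with
  | mem x hx =>
    obtain ⟨f, hf, rfl⟩ := hx
    refine ⟨f, hf, b, le_rfl, ?_⟩
    rwa [coeff_single_foldHom he hes hs] at hb
  | zero => simp at hb
  | add x y _ _ hx hy =>
    rw [coeff_add] at hb
    by_cases hx0 : coeff (Finsupp.single (σ s) b) x = 0
    · rw [hx0, zero_add] at hb
      exact hy hb
    · exact hx hx0
  | smul h x _ hx =>
    rw [smul_eq_mul, coeff_mul] at hb
    obtain ⟨y, hy, hy0⟩ := Finset.exists_ne_zero_of_sum_ne_zero hb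
    rw [Finsupp.antidiagonal_single, Finset.mem_map] at hy
    obtain ⟨⟨α, β⟩, hαβ, rfl⟩ := hy
    rw [Finset.HasAntidiagonal.mem_antidiagonal] at hαβ
    obtain ⟨f, hf, b', hb', h⟩ := hx (b := β) (right_ne_zero_of_mul hy0)
    exact ⟨f, hf, b', hb'.trans (by simp only at hαβ; omega), h⟩

/-- Covers empty sets too, so critical exponents can be compared without any cone hypothesis. -/
lemma Nat.sInf_eq_sInf_of_subset {S T : Set ℕ} (hST : S ⊆ T) (h : ∀ t ∈ T, ∃ s ∈ S, s ≤ t) :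
    sInf S = sInf T := by
  rcases T.eq_empty_or_nonempty with rfl | hT
  · rw [Set.subset_empty_iff.mp hST]
  · obtain ⟨s, hs, hle⟩ := h _ (Nat.sInf_mem hT)
    exact le_antisymm ((Nat.sInf_le hs).trans hle) (Nat.sInf_le (hST (Nat.sInf_mem ⟨s, hs⟩)))

theorem critExp_eq_of_toricIdeal_eq_map [Fintype ι] [Fintype ι'] {σ : ι → ι'} {e : ι → ℕ}
    (he : ∀ l, 0 < e l) {a : ι → Fin m → ℕ} {a' : ι' → Fin m → ℕ}
    (ha : ∀ l, a l = e l • a' (σ l)) (ha0 : ∀ l, a l ≠ 0)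
    (hmap : toricIdeal k a' = (toricIdeal k a).map (foldHom k σ e))
    {s : ι} (hes : e s = 1) (hs : ∀ l, σ l = σ s → l = s) :
    critExp a' (σ s) = critExp a s := by
  classical
  refine (Nat.sInf_eq_sInf_of_subset ?_ ?_).symm
  · rintro b ⟨hb0, hb⟩
    refine ⟨hb0, ?_⟩
    rw [ha s, hes, one_smul] at hb
    refine (AddSubmonoid.closure_le (S := AddSubmonoid.closure (a' '' {t | t ≠ σ s}))).mpr ?_ hb
    rintro _ ⟨t, ht, rfl⟩
    rw [ha t]
    exact nsmul_mem (AddSubmonoid.subset_closure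
      (Set.mem_image_of_mem a' (show σ t ≠ σ s from fun h => ht (hs t h)))) _
  · rintro b ⟨hb0, hb⟩
    obtain ⟨c, hc, hcb⟩ := (mem_closure_image_ne_iff _ _ _).mp hb
    -- A relation for a' gives a binomial containing a pure power. As the ideal is extended from
    -- I_A, an element of I_A contains a pure power of x_s of no larger exponent, which yields a
    -- relation for a.
    have hmem : (monomial (Finsupp.single (σ s) b) 1 - monomial c 1 : MvPolynomial ι' k) ∈
        toricIdeal k a' := by
      rw [toricIdeal, RingHom.mem_ker, map_sub, aeval_toric_monomial, aeval_toric_monomial, hcb]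
      have hsum : ∑ t, Finsupp.single (σ s) b t • a' t = b • a' (σ s) := by
        simp [Finsupp.single_apply]
      rw [hsum, sub_self]
    rw [hmap] at hmem
    have hne : c ≠ Finsupp.single (σ s) b := by
      rintro rfl
      rw [Finsupp.single_eq_same] at hc
      omega
    obtain ⟨f, hf, b', hb', hcoeff⟩ := exists_coeff_single_ne_zero_of_mem_map_foldHom he hes hs
      hmem (b := b) (by simp [coeff_monomial, hne])
    obtain ⟨b'', hle, h⟩ := exists_le_of_coeff_single_ne_zero ha0 hf hcoeff
    exact ⟨b'', h, hle.trans hb'⟩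

lemma memConeOthers_iff_of_eq_smul {σ : ι → ι'} (hσ : Function.Surjective σ) {e : ι → ℕ}
    (he : ∀ l, 0 < e l) {a : ι → Fin m → ℕ} {a' : ι' → Fin m → ℕ}
    (ha : ∀ l, a l = e l • a' (σ l))
    {s : ι} (hes : e s = 1) (hs : ∀ l, σ l = σ s → l = s) :
    MemConeOthers a' (σ s) ↔ MemConeOthers a s := by
  have hvec : a' (σ s) = a s := by rw [ha s, hes, one_smul]
  have hhull : PointedCone.hull ℝ
      ((fun t => (fun l => (a' t l : ℝ) : Fin m → ℝ)) '' {t | t ≠ σ s}) =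
      PointedCone.hull ℝ ((fun t => (fun l => (a t l : ℝ) : Fin m → ℝ)) '' {t | t ≠ s}) := by
    refine le_antisymm (Submodule.span_le.mpr ?_) (Submodule.span_le.mpr ?_)
    · rintro _ ⟨r, hr, rfl⟩
      obtain ⟨t, rfl⟩ := hσ r
      have ht : t ≠ s := fun h => hr (congrArg σ h)
      have hpos : (0 : ℝ) < e t := by exact_mod_cast he t
      have : (fun l => (a' (σ t) l : ℝ)) =
          (⟨(e t : ℝ)⁻¹, inv_nonneg.mpr hpos.le⟩ : {c : ℝ // 0 ≤ c}) •
            (fun l => (a t l : ℝ) : Fin m → ℝ) := by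
        ext l
        change _ = (e t : ℝ)⁻¹ * (a t l : ℝ)
        rw [ha t, Pi.smul_apply, smul_eq_mul]
        push_cast
        field_simp
      simp only [this]
      exact Submodule.smul_mem _ _ (Submodule.subset_span ⟨t, ht, rfl⟩)
    · rintro _ ⟨t, ht, rfl⟩
      have : (fun l => (a t l : ℝ)) =
          (⟨(e t : ℝ), Nat.cast_nonneg _⟩ : {c : ℝ // 0 ≤ c}) •
            (fun l => (a' (σ t) l : ℝ) : Fin m → ℝ) := by
        ext l
        change _ = (e t : ℝ) * (a' (σ t) l : ℝ)
        rw [ha t, Pi.smul_apply, smul_eq_mul]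
        push_cast
        rfl
      simp only [this]
      exact Submodule.smul_mem _ _ (Submodule.subset_span
        ⟨σ t, fun h : σ t = σ s => ht (hs t h), rfl⟩)
  rw [MemConeOthers, MemConeOthers, hhull, hvec]

end ToricFold

/-! ### Assembly of the theorem. -/

open MvPolynomial in
theorem theorem2p7 {k : Type*} [Field k] {n m : ℕ} (a : Fin (n + 1) → Fin m → ℕ)
    (ha0 : ∀ r, a r ≠ 0) (hinj : Function.Injective a)
    (hCI : IsCompleteIntersection (toricIdeal k a))
    (i j : Fin (n + 1)) (hij : i < j)
    (hi : MemConeOthers a i) (hj : MemConeOthers a j)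
    (hm : critExp a i • a i = critExp a j • a j) :
    ((∀ r, mergeGcd a i j r ≠ 0) ∧ Function.Injective (mergeGcd a i j)) ∧
    IsCompleteIntersection (toricIdeal k (mergeGcd a i j)) ∧
    (toricIdeal k (mergeGcd a i j)).height + 1 = (toricIdeal k a).height ∧
    ∀ r : Fin n, j.succAbove r ≠ i →
      (MemConeOthers (mergeGcd a i j) r ↔ MemConeOthers a (j.succAbove r)) ∧
      (MemConeOthers (mergeGcd a i j) r →
        critExp (mergeGcd a i j) r = critExp a (j.succAbove r)) := by
  classical
  obtain ⟨i₀, rfl⟩ := Fin.exists_succAbove_eq hij.ne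
  set i := j.succAbove i₀ with hi_def
  set q := critExp a i
  set p := critExp a j
  have hq0 : 0 < q := hi.critExp_mem.1
  have hp0 : 0 < p := hj.critExp_mem.1
  have hcop : Nat.Coprime q p := coprime_critExp hij.ne hi hm
  obtain ⟨hai, haj⟩ := eq_smul_gcdVec hp0 hcop hm
  -- σ sends both i and j to the merged index i₀. The exponents are crossed: a_i = p·g and a_j =
  -- q·g, so `e` is p at i and q at j.
  let σ : Fin (n + 1) → Fin n := j.insertNth i₀ id
  let e : Fin (n + 1) → ℕ := j.insertNth q fun r => if r = i₀ then p else 1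
  have hσj : σ j = i₀ := by simp [σ]
  have hσ : ∀ r, σ (j.succAbove r) = r := fun r => by simp [σ]
  have hej : e j = q := by simp [e]
  have hei : e i = p := by simp [e, i]
  have her : ∀ r, r ≠ i₀ → e (j.succAbove r) = 1 := fun r hr => by simp [e, hr]
  have hσsurj : Function.Surjective σ := fun r => ⟨_, hσ r⟩
  have he : ∀ l, 0 < e l := by
    intro l
    rcases Fin.eq_self_or_eq_succAbove j l with rfl | ⟨r, rfl⟩
    · rwa [hej]
    · by_cases hr : r = i₀
      · rw [hr]
        rwa [← hi_def, hei]
      · rw [her r hr]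
        exact one_pos
  have ha' : ∀ r, r ≠ i₀ → mergeGcd a i j r = a (j.succAbove r) := fun r hr => by
    rw [mergeGcd, if_neg]
    exact fun h => hr (Fin.succAbove_right_injective h)
  have ha'i : mergeGcd a i j i₀ = gcdVec (a i) (a j) := by
    rw [mergeGcd, if_pos rfl]
  have ha : ∀ l, a l = e l • mergeGcd a i j (σ l) := by
    intro l
    rcases Fin.eq_self_or_eq_succAbove j l with rfl | ⟨r, rfl⟩
    · rw [hej, hσj, ha'i]
      exact haj
    · rw [hσ]
      by_cases hr : r = i₀
      · subst hr
        rw [← hi_def, hei, ha'i]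
        exact hai
      · rw [her r hr, one_smul, ha' r hr]
  have hne0 : ∀ r, mergeGcd a i j r ≠ 0 := fun r h => by
    apply ha0 (j.succAbove r)
    rw [ha, hσ, h, smul_zero]
  -- If g were another vector of the family, a_i and a_j would be multiples of it, so q = p = 1 and
  -- a_i = a_j.
  have hgcd : ∀ r, r ≠ i₀ → gcdVec (a i) (a j) ≠ a (j.succAbove r) := by
    intro r hr h
    have hri : j.succAbove r ≠ i := fun h => hr (Fin.succAbove_right_injective h)
    have hrj : j.succAbove r ≠ j := Fin.succAbove_ne j r
    have hq1 : q ≤ 1 := Nat.sInf_le ⟨one_pos, by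
      rw [one_smul, hai, h]
      exact nsmul_mem (AddSubmonoid.subset_closure (Set.mem_image_of_mem a hri)) _⟩
    have hp1 : p ≤ 1 := Nat.sInf_le ⟨one_pos, by
      rw [one_smul, haj, h]
      exact nsmul_mem (AddSubmonoid.subset_closure (Set.mem_image_of_mem a hrj)) _⟩
    have hqp : q = p := by omega
    refine hij.ne (hinj (hai.trans (Eq.trans ?_ haj.symm)))
    rw [hqp]
  have hinj' : Function.Injective (mergeGcd a i j) := by
    intro r s hrs
    by_cases hr : r = i₀
    · by_cases hs : s = i₀
      · rw [hr, hs]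
      · rw [hr, ha'i, ha' s hs] at hrs
        exact absurd hrs (hgcd s hs)
    · by_cases hs : s = i₀
      · rw [hs, ha'i, ha' r hr] at hrs
        exact absurd hrs.symm (hgcd r hr)
      · rw [ha' r hr, ha' s hs] at hrs
        exact Fin.succAbove_right_injective (hinj hrs)
  have hwpos : ∀ {ν : ℕ} {b : Fin ν → Fin m → ℕ}, (∀ r, b r ≠ 0) → ∀ r, 0 < ∑ l, b r l := by
    intro ν b hb r
    rw [Nat.pos_iff_ne_zero]
    intro h
    apply hb r
    ext l
    exact (Finset.sum_eq_zero_iff.mp h) l (Finset.mem_univ l)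
  let w : Fin (n + 1) → ℕ := fun l => ∑ x, a l x
  let w' : Fin n → ℕ := fun l => ∑ x, mergeGcd a i j l x
  have hww' : ∀ l, w l = e l * w' (σ l) := fun l => by
    simp only [w, w']
    rw [ha l, Finset.mul_sum]
    rfl
  let f : MvPolynomial (Fin (n + 1)) k := X i ^ q - X j ^ p
  have hfI : f ∈ toricIdeal k a := X_pow_sub_X_pow_mem_toricIdeal hm
  have hfm : f ∉ RingHom.ker (constantCoeff : MvPolynomial (Fin (n + 1)) k →+* k) *
      toricIdeal k a := by
    intro h
    have h0 := coeff_single_critExp_eq_zero ha0 i h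
    have hne : Finsupp.single j p ≠ Finsupp.single i q := by
      intro h
      rcases (Finsupp.single_eq_single_iff _ _ _ _).mp h with ⟨h, -⟩ | ⟨h, -⟩
      · exact hij.ne h.symm
      · omega
    simp only [f, coeff_sub, X_pow_eq_monomial, coeff_monomial] at h0
    rw [if_pos rfl, if_neg hne, sub_zero] at h0
    exact one_ne_zero h0
  have hfhom : IsWeightHomogeneous w f := by
    have hw : w i * q = w j * p := by
      have h := congrArg (fun v => ∑ x, v x) hm
      simp only [Pi.smul_apply, smul_eq_mul, ← Finset.mul_sum] at h
      rw [mul_comm, mul_comm (w j)]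
      exact h
    refine ⟨w i * q, ?_⟩
    simp only [f, map_sub, map_pow, weightHom_X, mul_pow, ← pow_mul]
    rw [hw]
    ring
  have hf0 : foldHom k σ e f = 0 := by
    simp only [f, map_sub, map_pow, foldHom_X, hσj, hej, hei, i, hσ]
    ring
  obtain ⟨fs, hlen, hfs, hspan⟩ := (isWeightHomogeneousIdeal_toricIdeal a).exists_generators
    (hwpos ha0) hfI hfhom hfm
  -- The complete intersection hypothesis enters here.
  have hlen' : (fs.length + 1 : ℕ) ≤ (toricIdeal k a).height := by
    rw [← hCI]
    exact_mod_cast hlen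
  obtain ⟨hmap, hspanht, hht⟩ := eq_map_and_height_of_comap_foldHom_eq he hσsurj (by simp)
    (hwpos hne0) (comap_foldHom_toricIdeal ha) (toricIdeal_le_ker_constantCoeff ha0) hf0
    (fun g hg => (hfs g hg).foldHom hww') hspan hlen' (x := X i) (by simp)
    (X_notMem_toricIdeal a i)
    (exists_pow_mul_mem_range_foldHom (he i) (he j) (by rw [hσj, hσ])
      (by rw [hei, hej]; exact hcop.symm)
      (fun r hr => ⟨j.succAbove r, hσ r, her r (by rwa [hσ] at hr)⟩))
  refine ⟨⟨hne0, hinj'⟩, hspanht, hht, fun r hr => ?_⟩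
  have hr' : r ≠ i₀ := fun h => hr (by rw [h])
  have hs : ∀ l, σ l = σ (j.succAbove r) → l = j.succAbove r := by
    intro l hl
    rw [hσ] at hl
    rcases Fin.eq_self_or_eq_succAbove j l with rfl | ⟨s, rfl⟩
    · exact absurd (hl.symm.trans hσj) hr'
    · rw [← hl, hσ]
  have h1 := memConeOthers_iff_of_eq_smul hσsurj he ha (her r hr') hs
  have h2 := critExp_eq_of_toricIdeal_eq_map he ha ha0 hmap (her r hr') hs
  rw [hσ] at h1 h2
  exact ⟨h1, fun _ => h2⟩
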